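/- Conventions. Let $(Z,d)$ be a complete separable metric space with its Borel $\sigma$-algebra. For a measurable space $E$, $\mathcal P(E)$ denotes the probability measures on $E$; $\mathcal H(\nu|\gamma)=\int\log\frac{d\nu}{d\gamma}\,d\nu$ if $\nu\ll\gamma$ and $+\infty$ otherwise; $\inf\emptyset=\infty$ and $0\cdot\infty=0$. For $c\colon E\times\mathcal P(E)\to[0,\infty]$ and finite measures $\nu_1,\nu_2$ on $E$ set $$\mathcal T_c(\nu_2|\nu_1)=\inf\int c(x,p_x)\,\nu_1(dx),$$ the infimum running over all couplings $N(dx\,dy)=p_x(dy)\,\nu_1(dx)$ with first marginal $\nu_1$ and second marginal $\nu_2$ ($p$ a probability kernel). A measure $\gamma\in\mathcal P(E)$ satisfies $(\mathbf T_c)$ with constants $a_1,a_2\in(0,\infty]$ if $$\mathcal T_c(\nu_2|\nu_1)\le a_1\mathcal H(\nu_1|\gamma)+a_2\mathcal H(\nu_2|\gamma)\qquad\text{for all }\nu_1,\nu_2\in\mathcal P(E).$$ For $\rho\colon E\times E\to[0,\infty]$ write $\mathcal T_\rho$ for $\mathcal T_c$ with $c(x,p)=\int\rho(x,y)\,p(dy)$,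 and let $(\widetilde{\mathbf T}_{\alpha,\rho})$ be $(\mathbf T_c)$ with $c(x,p)=\alpha\big(\int\rho(x,y)\,p(dy)\big)$. Let $\mathcal M_{\mathbb N}(Z)$ be the set of finite (possibly empty) sums of Dirac masses on $Z$, and $\mathcal M_n(Z)=\{\xi\in\mathcal M_{\mathbb N}(Z):\xi(Z)=n\}$, with the weak topology and its Borel $\sigma$-algebra. For $\mu\in\mathcal P(Z)$, $B_{\mu,n}\in\mathcal P(\mathcal M_n(Z))$ is the law of $\sum_{i=1}^n\delta_{X_i}$ with $X_1,\dots,X_n$ i.i.d. of law $\mu$. For $\xi,\chi\in\mathcal M_{\mathbb N}(Z)$, the partial transport cost from $\xi$ to $\chi$ is $$\mathcal T_{\rho,0}(\chi|\xi)=\begin{cases}\min\{\mathcal T_\rho(\chi|\xi'):\ \xi'\in\mathcal M_{\mathbb N}(Z),\ \xi'\le\xi,\ \xi'(Z)=\chi(Z)\}&\text{if }\xi(Z)\ge\chi(Z),\\ \min\{\mathcal T_\rho(\chi'|\xi):\ \chi'\in\mathcal M_{\mathbb N}(Z),\ \chi'\le\chi,\ \chi'(Z)=\xi(Z)\}&\text{if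 }\xi(Z)<\chi(Z).\end{cases}$$ Theorem. Let $n\in\mathbb N=\{0,1,2,\dots\}$, $\mu\in\mathcal P(Z)$ and $a_1,a_2\in(0,\infty]$. Let $\rho\colon Z\times Z\to[0,\infty]$ be lower semicontinuous and let $\alpha\colon[0,\infty]\to[0,\infty]$ be convex, nondecreasing and such that $\alpha(\infty)=\lim_{u\to\infty}\alpha(u)$. If $\mu$ satisfies $(\widetilde{\mathbf T}_{\alpha,\rho})$ on $Z$ with constants $a_1,a_2$, then $B_{\mu,n}$ satisfies $(\mathbf T_c)$ on $\mathcal M_n(Z)$ with the same constants $a_1,a_2$, where, for $\xi\in\mathcal M_n(Z)$ and $\Pi\in\mathcal P(\mathcal M_n(Z))$, with $\xi(x)=\xi(\{x\})$, $$c(\xi,\Pi)=\int\alpha\left(\frac1{\xi(x)}\int\mathcal T_{\rho,0}\big(\chi\,\big|\,\xi(x)\delta_x\big)\,\Pi(d\chi)\right)\xi(dx).$$ -/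

import Mathlib

open MeasureTheory ProbabilityTheory Set
open scoped ENNReal NNReal Topology

noncomputable section

namespace MartonBinomial

/-! ### Generalized transport costs -/

section Transport

variable {E : Type*} [MeasurableSpace E]

/-- `N` is a coupling of `ν₁` (first marginal) and `ν₂` (second marginal). -/
def IsCoupling (N : Measure (E × E)) (ν₁ ν₂ : Measure E) : Prop :=
  N.fst = ν₁ ∧ N.snd = ν₂

/-- The generalized transport cost `T_c(ν₂ | ν₁)` from `ν₁` to `ν₂`: the infimum of
`∫ c(x, p_x) ν₁(dx)` over all couplings `N(dx dy) = p_x(dy) ν₁(dx)` of `ν₁` and `ν₂`, where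
`p` is a disintegration kernel of `N` along `ν₁`.  The target comes first, as in `T_c(ν₂ | ν₁)`.
The infimum over the empty set is `∞`. -/
def transportCost (c : E → ProbabilityMeasure E → ℝ≥0∞) (ν₂ ν₁ : Measure E) : ℝ≥0∞ :=
  sInf {r | ∃ (N : Measure (E × E)) (p : Kernel E E) (hp : IsMarkovKernel p),
    IsCoupling N ν₁ ν₂ ∧ N = ν₁ ⊗ₘ p ∧
      r = ∫⁻ x, c x ⟨p x, hp.isProbabilityMeasure x⟩ ∂ν₁}

/-- The linear cost `c(x, p) = ∫ ω(x, y) p(dy)`. -/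
def linearCost (ω : E → E → ℝ≥0∞) (x : E) (p : ProbabilityMeasure E) : ℝ≥0∞ :=
  ∫⁻ y, ω x y ∂(p : Measure E)

/-- The Marton-type cost `c(x, p) = α (∫ ρ(x, y) p(dy))`. -/
def martonCost (α : ℝ≥0∞ → ℝ≥0∞) (ρ : E → E → ℝ≥0∞) (x : E) (p : ProbabilityMeasure E) :
    ℝ≥0∞ :=
  α (∫⁻ y, ρ x y ∂(p : Measure E))

/-- The transport-entropy inequality `(T_c)` with constants `a₁, a₂ ∈ [0, ∞]`:
`T_c(ν₂ | ν₁) ≤ a₁ H(ν₁ | γ) + a₂ H(ν₂ | γ)` for all probability measures `ν₁, ν₂`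
(with `0 * ∞ = 0`).  Between probability measures, `klDiv` is the relative entropy. -/
def TransportEntropyInequality (c : E → ProbabilityMeasure E → ℝ≥0∞) (γ : Measure E)
    (a₁ a₂ : ℝ≥0∞) : Prop :=
  ∀ ν₁ ν₂ : ProbabilityMeasure E,
    transportCost c (ν₂ : Measure E) (ν₁ : Measure E) ≤
      a₁ * InformationTheory.klDiv (ν₁ : Measure E) γ +
        a₂ * InformationTheory.klDiv (ν₂ : Measure E) γ

/-- Finite configurations: finite (possibly empty) sums of Dirac masses. -/
def IsFiniteConfiguration (ξ : Measure E) : Prop :=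
  ∃ (k : ℕ) (a : Fin k → E), ξ = ∑ i, Measure.dirac (a i)

open scoped Classical in
/-- The partial transport cost `T_{c,0}(χ | ξ)` from `ξ` to `χ`, for finite configurations:
the configuration with the larger mass is replaced by its best sub-configuration having the
same mass as the other one. -/
def partialTransportCost (c : E → ProbabilityMeasure E → ℝ≥0∞) (χ ξ : Measure E) : ℝ≥0∞ :=
  if χ univ ≤ ξ univ then
    sInf {r | ∃ ξ' : Measure E, IsFiniteConfiguration ξ' ∧ ξ' ≤ ξ ∧ ξ' univ = χ univ ∧
      r = transportCost c χ ξ'}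
  else
    sInf {r | ∃ χ' : Measure E, IsFiniteConfiguration χ' ∧ χ' ≤ χ ∧ χ' univ = ξ univ ∧
      r = transportCost c χ' ξ}

end Transport

/-! ### Configurations of fixed size and the binomial process -/

section Configurations

variable {Z : Type*} [MeasurableSpace Z]

/-- The space `M_n(Z)` of configurations of total mass `n` on `Z`. -/
def Configuration (Z : Type*) [MeasurableSpace Z] (n : ℕ) : Type _ :=
  {ξ : FiniteMeasure Z //
    IsFiniteConfiguration (ξ : Measure Z) ∧ (ξ : Measure Z) univ = n}

/-- The underlying measure of a configuration. -/
def Configuration.toMeasure {n : ℕ} (ξ : Configuration Z n) : Measure Z :=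
  (ξ.1 : Measure Z)

/-- `M_n(Z)` carries the weak topology, as a subspace of the finite measures. -/
instance [TopologicalSpace Z] [OpensMeasurableSpace Z] (n : ℕ) :
    TopologicalSpace (Configuration Z n) :=
  inferInstanceAs (TopologicalSpace {ξ : FiniteMeasure Z //
    IsFiniteConfiguration (ξ : Measure Z) ∧ (ξ : Measure Z) univ = n})

/-- `M_n(Z)` carries the Borel `σ`-algebra of the weak topology. -/
instance [TopologicalSpace Z] [OpensMeasurableSpace Z] (n : ℕ) :
    MeasurableSpace (Configuration Z n) :=
  borel (Configuration Z n)

instance [TopologicalSpace Z] [OpensMeasurableSpace Z] (n : ℕ) :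
    BorelSpace (Configuration Z n) :=
  ⟨rfl⟩

/-- The finite measure `δ_{z_1} + ⋯ + δ_{z_n}`. -/
def diracSumMeasure {n : ℕ} (z : Fin n → Z) : FiniteMeasure Z :=
  ⟨∑ i, Measure.dirac (z i), inferInstance⟩

/-- The map `S^n : Z^n → M_n(Z)`, `z ↦ δ_{z_1} + ⋯ + δ_{z_n}`. -/
def diracSum {n : ℕ} (z : Fin n → Z) : Configuration Z n :=
  ⟨diracSumMeasure z, ⟨n, z, rfl⟩, by
    change (∑ i, Measure.dirac (z i) : Measure Z) univ = n
    simp⟩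

/-- The law `B_{μ,n}` of `δ_{X_1} + ⋯ + δ_{X_n}`, where `X_1, …, X_n` are i.i.d. of law `μ`. -/
def binomialProcess [TopologicalSpace Z] [OpensMeasurableSpace Z] (μ : Measure Z) (n : ℕ) :
    Measure (Configuration Z n) :=
  (Measure.pi fun _ : Fin n => μ).map diracSum

/-- The cost on `M_n(Z)`:
`c(ξ, P) = ∫ α ((1 / ξ(x)) ∫ T_{ρ,0}(χ | ξ(x) δ_x) P(dχ)) ξ(dx)`, with `ξ(x) = ξ({x})`. -/
def binomialMartonCost [TopologicalSpace Z] [OpensMeasurableSpace Z] (α : ℝ≥0∞ → ℝ≥0∞)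
    (ρ : Z → Z → ℝ≥0∞) (n : ℕ) (ξ : Configuration Z n)
    (P : ProbabilityMeasure (Configuration Z n)) : ℝ≥0∞ :=
  ∫⁻ x, α ((ξ.toMeasure {x})⁻¹ *
      ∫⁻ χ, partialTransportCost (linearCost ρ) χ.toMeasure
        (ξ.toMeasure {x} • Measure.dirac x) ∂(P : Measure (Configuration Z n))) ∂ξ.toMeasure

/-- `S^n` is weakly continuous. -/
theorem continuous_diracSum [TopologicalSpace Z] [OpensMeasurableSpace Z] (n : ℕ) :
    Continuous (diracSum : (Fin n → Z) → Configuration Z n) := by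
  suffices h : Continuous (diracSumMeasure : (Fin n → Z) → FiniteMeasure Z) from
    Continuous.subtype_mk h _
  rw [continuous_iff_continuousAt]
  intro z
  refine FiniteMeasure.tendsto_iff_forall_lintegral_tendsto.2 fun f => ?_
  have hf : Measurable fun x => ((f x : ℝ≥0) : ℝ≥0∞) :=
    (ENNReal.continuous_coe.comp f.continuous).measurable
  have key : ∀ w : Fin n → Z,
      ∫⁻ x, ((f x : ℝ≥0) : ℝ≥0∞) ∂(∑ i, Measure.dirac (w i) : Measure Z)
        = ∑ i, ((f (w i) : ℝ≥0) : ℝ≥0∞) := by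
    intro w
    simp [lintegral_finsetSum_measure, lintegral_dirac' _ hf]
  change Filter.Tendsto (fun w : Fin n → Z =>
      ∫⁻ x, ((f x : ℝ≥0) : ℝ≥0∞) ∂(∑ i, Measure.dirac (w i) : Measure Z)) (𝓝 z)
    (𝓝 (∫⁻ x, ((f x : ℝ≥0) : ℝ≥0∞) ∂(∑ i, Measure.dirac (z i) : Measure Z)))
  simp only [key]
  have hc : Continuous fun w : Fin n → Z => ∑ i, ((f (w i) : ℝ≥0) : ℝ≥0∞) :=
    continuous_finsetSum _ fun i _ =>
      ENNReal.continuous_coe.comp (f.continuous.comp (continuous_apply i))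
  exact hc.tendsto z

/-- `S^n` is measurable, so that the push-forward defining `B_{μ,n}` is the genuine one. -/
theorem measurable_diracSum [TopologicalSpace Z] [SecondCountableTopology Z] [BorelSpace Z]
    (n : ℕ) : Measurable (diracSum : (Fin n → Z) → Configuration Z n) :=
  (continuous_diracSum n).measurable

/-- `B_{μ,n}` is a probability measure on `M_n(Z)`. -/
theorem isProbabilityMeasure_binomialProcess [TopologicalSpace Z] [SecondCountableTopology Z]
    [BorelSpace Z] (μ : Measure Z) [IsProbabilityMeasure μ] (n : ℕ) :
    IsProbabilityMeasure (binomialProcess μ n) :=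
  Measure.isProbabilityMeasure_map (measurable_diracSum n).aemeasurable

end Configurations

end MartonBinomial

end

/-!
The proof lifts the inequality from configurations to ordered samples and tensorizes there.

*Ordering.* Let `R` be the kernel that sends a configuration in `M_n(Z)` to a uniformly random
ordering of its points. Then `R ∘ B_{μ,n} = μ^{⊗n}`, so by the data processing inequality
`H(R ∘ ν | μ^{⊗n}) ≤ H(ν | B_{μ,n})`, while forgetting the order sends `R ∘ ν` back to `ν`. A
coupling kernel `p` of `R ∘ ν₁` and `R ∘ ν₂` on `Z^n` therefore induces a coupling kernel of `ν₁`
and `ν₂`: order at random, apply `p`, forget the order (`orderingKernel`,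
`binomialMartonCost_le_lintegral`). Its cost does not exceed
`∑ i, α (∫ ρ (x i) (y i) p_x(dy))` on average. Indeed the mass of `ξ` at `z` may be sent to the
points `y j` with `x j = z`, which bounds the partial transport cost, and the averages over these
indices and over the orderings are taken out of `α` by Jensen's inequality.

*Tensorization* (`HasEntropyCouplings.prod`). Almost optimal couplings of the first coordinates are
combined with almost optimal couplings of the conditional laws of the remaining ones. The chain rule
splits the entropies accordingly, and Jensen's inequality bounds the cost of the glued coupling. The
conditional couplings have to depend measurably on the first coordinates. Since `α` may jump to `∞`
at the end of its domain, no lower semicontinuity of the cost is available, and instead of an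
optimal coupling one selects any coupling whose cost is below the required bound: these form a Borel
set, and a Borel set with nonempty sections admits a measurable selection up to null sets
(`exists_measurable_ae_selection`). To apply this, the couplings are parametrized by the standard
Borel space `ℚ → ℝ` through distribution functions.

*Jensen* (`map_lintegral_le_lintegral`). Supporting lines of `α` exist at every point that is not
the right end of the domain; at the right end an integrand with finite cost that has this mean is
constant. Continuity of `α` at `∞` handles integrands of infinite mean. Monotonicity of `α` makes
the inequality hold for lower integrals of nonmeasurable functions, so that no measurability of the
partial transport cost is needed.
-/

open MeasureTheory ProbabilityTheory Set
open scoped ENNReal NNReal Topology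

noncomputable section

namespace MartonBinomial

/-! ### Measurable selection up to null sets -/

section Selection

lemma isCompact_Iic_nat_nat (k : ℕ → ℕ) : IsCompact (Set.Iic k) := by
  have : Set.Iic k = Set.univ.pi fun i => Set.Iic (k i) := by
    ext s; simp [Pi.le_def]
  rw [this]
  exact isCompact_univ_pi fun i => (Set.finite_Iic (k i)).isCompact

/-- A sequence satisfying the first `j` of the bounds `s i ≤ k i` agrees up to index `j` with a
point of the compact box `{s | s ≤ k}`; hence an open set containing the box contains all
sequences satisfying sufficiently many of the bounds. -/
lemma exists_truncated_box_subset {k : ℕ → ℕ} {U : Set (ℕ → ℕ)} (hU : IsOpen U)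
    (hk : Set.Iic k ⊆ U) : ∃ j, {s : ℕ → ℕ | ∀ i < j, s i ≤ k i} ⊆ U := by
  let : MetricSpace (ℕ → ℕ) := PiNat.metricSpaceNatNat
  obtain ⟨δ, hδ, hsub⟩ := (isCompact_Iic_nat_nat k).exists_thickening_subset_open hU hk
  obtain ⟨j, hj⟩ := exists_pow_lt_of_lt_one hδ (by norm_num : (1 / 2 : ℝ) < 1)
  refine ⟨j, fun s hs => hsub ?_⟩
  rw [Metric.mem_thickening_iff]
  refine ⟨fun i => min (s i) (k i), fun i => min_le_right _ _, lt_of_le_of_lt ?_ hj⟩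
  rw [← PiNat.mem_cylinder_iff_dist_le]
  intro i hi
  exact (min_eq_left (hs i hi)).symm

variable {X : Type*} [TopologicalSpace X] [T2Space X] [MeasurableSpace X] [BorelSpace X]

/-- Inner regularity of analytic sets: the outer measure of a continuous image of `ℕ → ℕ` is
approximated from below by the images of compact boxes. -/
lemma exists_le_measure_image_box {m : Measure X} [IsFiniteMeasure m] {g : (ℕ → ℕ) → X}
    (hg : Continuous g) {c : ℝ≥0∞} (hc : c < m (range g)) :
    ∃ k : ℕ → ℕ, c ≤ m (g '' Set.Iic k) := by
  -- The bounds are chosen one coordinate at a time, using continuity from below of `m`.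
  let B : ℕ → (ℕ → ℕ) → Set (ℕ → ℕ) := fun j k => {s | ∀ i < j, s i ≤ k i}
  have step : ∀ (j : ℕ) (k : ℕ → ℕ), c < m (g '' B j k) →
      ∃ l, c < m (g '' B (j + 1) (Function.update k j l)) := by
    intro j k h
    have hU : g '' B j k = ⋃ l, g '' (B j k ∩ {s | s j ≤ l}) := by
      rw [← image_iUnion, ← inter_iUnion]
      congr 1
      ext s
      simp only [mem_inter_iff, mem_iUnion, mem_ofPred_eq]
      exact ⟨fun hs => ⟨hs, s j, le_rfl⟩, fun hs => hs.1⟩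
    have hmono : Monotone fun l : ℕ => g '' (B j k ∩ {s | s j ≤ l}) := fun a b hab =>
      image_mono fun s hs => ⟨hs.1, le_trans hs.2 hab⟩
    rw [hU, hmono.measure_iUnion] at h
    obtain ⟨l, hl⟩ := lt_iSup_iff.1 h
    refine ⟨l, hl.trans_le (measure_mono (image_mono ?_))⟩
    rintro s ⟨hs, hsl⟩ i hi
    rcases Nat.lt_succ_iff_lt_or_eq.1 hi with hi' | rfl
    · rw [Function.update_of_ne hi'.ne]; exact hs i hi'
    · rw [Function.update_self]; exact hsl
  choose! L hL using step
  let u : ℕ → ℕ → ℕ := fun j => Nat.rec (fun _ => 0) (fun j k => Function.update k j (L j k)) j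
  have hu : ∀ j, c < m (g '' B j (u j)) := by
    intro j
    induction j with
    | zero =>
      refine hc.trans_le (measure_mono ?_)
      rintro _ ⟨s, rfl⟩
      exact ⟨s, fun i hi => absurd hi (Nat.not_lt_zero i), rfl⟩
    | succ j ih => exact hL j _ ih
  let k : ℕ → ℕ := fun i => u (i + 1) i
  have huk : ∀ j i, i < j → u j i = k i := by
    intro j i hij
    induction j with
    | zero => exact absurd hij (Nat.not_lt_zero i)
    | succ j ih =>
      rcases Nat.lt_succ_iff_lt_or_eq.1 hij with h | rfl
      · rw [← ih h]; exact Function.update_of_ne h.ne _ _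
      · rfl
  have hk : ∀ j, c < m (g '' B j k) := by
    intro j
    have : B j k = B j (u j) := by
      ext s
      exact forall₂_congr fun i hi => by rw [huk j i hi]
    rw [this]
    exact hu j
  refine ⟨k, ?_⟩
  have hanti : Antitone fun j => closure (g '' B j k) := fun a b hab =>
    closure_mono (image_mono fun s hs i hi => hs i (hi.trans_le hab))
  have hInter : ⋂ j, closure (g '' B j k) ⊆ g '' Set.Iic k := by
    intro x hx
    by_contra hxK
    obtain ⟨U, V, hU, hV, hKU, hxV, hUV⟩ :=
      SeparatedNhds.of_isCompact_isCompact ((isCompact_Iic_nat_nat k).image hg)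
        isCompact_singleton (disjoint_singleton_right.2 hxK)
    obtain ⟨j, hj⟩ := exists_truncated_box_subset (hU.preimage hg) (image_subset_iff.1 hKU)
    have h1 : x ∈ closure (g '' B j k) := mem_iInter.1 hx j
    obtain ⟨y, hyV, hy⟩ := mem_closure_iff.1 h1 V hV (hxV rfl)
    exact disjoint_left.1 hUV ((image_subset_iff.2 hj) hy) hyV
  have hlim := tendsto_measure_iInter_atTop (μ := m)
    (fun j => (isClosed_closure (s := g '' B j k)).measurableSet.nullMeasurableSet) hanti
    ⟨0, measure_ne_top _ _⟩
  refine le_trans ?_ (measure_mono hInter)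
  exact ge_of_tendsto' hlim fun j => (hk j).le.trans (measure_mono subset_closure)

/-- A continuous map on a compact subset of `ℕ → ℕ` has a measurable right inverse: take the
lexicographically smallest preimage. -/
lemma exists_measurable_rightInverse_of_isCompact {K : Set (ℕ → ℕ)} (hK : IsCompact K)
    {g : (ℕ → ℕ) → X} (hg : Continuous g) :
    ∃ t : X → ℕ → ℕ, Measurable t ∧ ∀ x ∈ g '' K, g (t x) = x := by
  classical
  -- `A j u n`: points with a preimage in `K` starting with `u 0, …, u (j - 1), n`.
  let A : (j : ℕ) → (ℕ → ℕ) → ℕ → Set X :=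
    fun j u n => g '' (K ∩ {s | (∀ i < j, s i = u i) ∧ s j = n})
  have hA : ∀ j u n, MeasurableSet (A j u n) := by
    intro j u n
    refine ((hK.inter_right ?_).image hg).measurableSet
    have : {s : ℕ → ℕ | (∀ i < j, s i = u i) ∧ s j = n}
        = (⋂ i, ⋂ _ : i < j, {s | s i = u i}) ∩ {s | s j = n} := by
      ext s; simp
    rw [this]
    refine IsClosed.inter (isClosed_iInter fun i => isClosed_iInter fun _ => ?_) ?_
    · exact isClosed_eq (continuous_apply i) continuous_const
    · exact isClosed_eq (continuous_apply j) continuous_const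
  let P : ℕ → (ℕ → ℕ) → X → ℕ → Prop := fun j u x n => x ∈ A j u n ∨ ∀ l, x ∉ A j u l
  have hP : ∀ j u x, ∃ n, P j u x n := by
    intro j u x
    by_cases h : ∃ n, x ∈ A j u n
    · exact ⟨h.choose, Or.inl h.choose_spec⟩
    · exact ⟨0, Or.inr fun l hl => h ⟨l, hl⟩⟩
  let pre : ℕ → X → ℕ → ℕ := fun j => Nat.rec (fun _ _ => 0)
    (fun j p x => Function.update (p x) j (Nat.find (hP j (p x) x))) j
  have pre_succ : ∀ j x, pre (j + 1) x
      = Function.update (pre j x) j (Nat.find (hP j (pre j x) x)) := fun _ _ => rfl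
  have hpre : ∀ j, Measurable (pre j) := by
    intro j
    induction j with
    | zero => exact measurable_const
    | succ j ih =>
      have hmem : ∀ n, MeasurableSet {x | x ∈ A j (pre j x) n} := by
        intro n
        have : {x | x ∈ A j (pre j x) n} = ⋃ u : Fin j → ℕ,
            {x | ∀ i : Fin j, pre j x i = u i} ∩
              A j (fun i => if h : i < j then u ⟨i, h⟩ else 0) n := by
          ext x
          simp only [mem_ofPred_eq, mem_iUnion, mem_inter_iff]
          have key : ∀ u v : ℕ → ℕ, (∀ i < j, u i = v i) → A j u n = A j v n := by
            intro u v huv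
            have : {s : ℕ → ℕ | (∀ i < j, s i = u i) ∧ s j = n}
                = {s | (∀ i < j, s i = v i) ∧ s j = n} := by
              ext s
              exact and_congr_left fun _ => forall₂_congr fun i hi => by rw [huv i hi]
            simp only [A, this]
          constructor
          · intro h
            refine ⟨fun i => pre j x i, fun _ => rfl, ?_⟩
            rwa [← key (pre j x)]
            intro i hi
            simp [hi]
          · rintro ⟨u, hu, h⟩
            rwa [key (pre j x)]
            intro i hi
            simp [hi, ← hu]
        rw [this]
        refine MeasurableSet.iUnion fun u => MeasurableSet.inter ?_ (hA _ _ _)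
        rw [ofPred_forall]
        exact MeasurableSet.iInter fun i =>
          measurableSet_eq_fun ((measurable_pi_apply _).comp ih) measurable_const
      have hfind : Measurable fun x => Nat.find (hP j (pre j x) x) := by
        refine measurable_find _ fun n => ?_
        have : {x | P j (pre j x) x n}
            = {x | x ∈ A j (pre j x) n} ∪ ⋂ l, {x | x ∈ A j (pre j x) l}ᶜ := by
          ext x; simp [P]
        rw [this]
        exact (hmem n).union (MeasurableSet.iInter fun l => (hmem l).compl)
      refine measurable_pi_lambda _ fun i => ?_
      simp only [pre_succ]
      rcases eq_or_ne i j with rfl | hij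
      · simpa using hfind
      · simp only [Function.update_of_ne hij]
        exact (measurable_pi_apply i).comp ih
  have pre_stable : ∀ x i j, i < j → pre j x i = pre (i + 1) x i := by
    intro x i j hij
    induction j with
    | zero => exact absurd hij (Nat.not_lt_zero i)
    | succ j ih =>
      rcases Nat.lt_succ_iff_lt_or_eq.1 hij with h | rfl
      · rw [← ih h, pre_succ, Function.update_of_ne h.ne]
      · rfl
  refine ⟨fun x i => pre (i + 1) x i, measurable_pi_lambda _ fun i =>
    (measurable_pi_apply i).comp (hpre (i + 1)), ?_⟩
  intro x hx
  have happrox : ∀ j, ∃ s ∈ K, g s = x ∧ ∀ i < j, s i = pre j x i := by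
    intro j
    induction j with
    | zero =>
      obtain ⟨s, hs, rfl⟩ := hx
      exact ⟨s, hs, rfl, fun i hi => absurd hi (Nat.not_lt_zero i)⟩
    | succ j ih =>
      obtain ⟨s, hs, hsx, hsi⟩ := ih
      have hmem : x ∈ A j (pre j x) (s j) := ⟨s, ⟨hs, hsi, rfl⟩, hsx⟩
      have := Nat.find_spec (hP j (pre j x) x)
      rcases this with h | h
      · obtain ⟨s', ⟨hs'K, hs'i, hs'j⟩, hs'x⟩ := h
        refine ⟨s', hs'K, hs'x, fun i hi => ?_⟩
        rw [pre_succ]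
        rcases Nat.lt_succ_iff_lt_or_eq.1 hi with hi | rfl
        · rw [Function.update_of_ne hi.ne, hs'i i hi]
        · rw [Function.update_self, hs'j]
      · exact absurd hmem (h _)
  choose s hsK hsx hsi using happrox
  have hlim : Filter.Tendsto s Filter.atTop (𝓝 fun i => pre (i + 1) x i) := by
    rw [tendsto_pi_nhds]
    intro i
    refine tendsto_const_nhds.congr' ?_
    filter_upwards [Filter.eventually_gt_atTop i] with j hj
    rw [hsi j i hj, pre_stable x i j hj]
  have := (hg.tendsto _).comp hlim
  exact tendsto_nhds_unique this (tendsto_const_nhds.congr fun j => (hsx j).symm)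

/-- A continuous map on `ℕ → ℕ` whose range has full measure has a measurable right inverse
almost everywhere. -/
lemma exists_measurable_ae_rightInverse (m : Measure X) [IsFiniteMeasure m] {g : (ℕ → ℕ) → X}
    (hg : Continuous g) (hm : ∀ᵐ x ∂m, x ∈ range g) :
    ∃ t : X → ℕ → ℕ, Measurable t ∧ ∀ᵐ x ∂m, g (t x) = x := by
  classical
  rcases eq_or_ne m 0 with rfl | hm0
  · exact ⟨fun _ _ => 0, measurable_const, by simp⟩
  have hrange : m (range g) = m univ :=
    measure_congr (by
      filter_upwards [hm] with x hx
      exact eq_iff_iff.2 ⟨fun _ => trivial, fun _ => hx⟩)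
  have hpos : 0 < m univ := by
    rw [pos_iff_ne_zero]; exact fun h => hm0 (Measure.measure_univ_eq_zero.1 h)
  obtain ⟨c, -, hclt, hclim⟩ := exists_seq_strictMono_tendsto' hpos
  have hc : ∀ n, ∃ k : ℕ → ℕ, c n ≤ m (g '' Set.Iic k) := fun n =>
    exists_le_measure_image_box hg (hrange ▸ (hclt n).2)
  choose k hk using hc
  choose t ht hgt using fun n =>
    exists_measurable_rightInverse_of_isCompact (isCompact_Iic_nat_nat (k n)) hg
  have hKm : ∀ n, MeasurableSet (g '' Set.Iic (k n)) := fun n =>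
    ((isCompact_Iic_nat_nat (k n)).image hg).measurableSet
  have hfull : m (⋃ n, g '' Set.Iic (k n))ᶜ = 0 := by
    rw [measure_compl (MeasurableSet.iUnion hKm) (measure_ne_top _ _), tsub_eq_zero_iff_le]
    exact le_of_tendsto' hclim fun n => (hk n).trans (measure_mono (subset_iUnion_of_subset n le_rfl))
  let p : ℕ → X → Prop := fun n x => x ∈ g '' Set.Iic (k n) ∨ ∀ l, x ∉ g '' Set.Iic (k l)
  have hp : ∀ x, ∃ n, p n x := by
    intro x
    by_cases h : ∃ n, x ∈ g '' Set.Iic (k n)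
    · exact ⟨h.choose, Or.inl h.choose_spec⟩
    · exact ⟨0, Or.inr fun l hl => h ⟨l, hl⟩⟩
  refine ⟨fun x => t (Nat.find (hp x)) x, Measurable.find ht (fun n => ?_) hp, ?_⟩
  · have : {x | p n x} = g '' Set.Iic (k n) ∪ ⋂ l, (g '' Set.Iic (k l))ᶜ := by
      ext x; simp [p]
    rw [this]
    exact (hKm n).union (MeasurableSet.iInter fun l => (hKm l).compl)
  · filter_upwards [measure_eq_zero_iff_ae_notMem.1 hfull] with x hx
    have hx' : ∃ l, x ∈ g '' Set.Iic (k l) := by simpa using hx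
    rcases Nat.find_spec (hp x) with h | h
    · exact hgt _ x h
    · obtain ⟨l, hl⟩ := hx'
      exact absurd hl (h l)

end Selection

/-- Measurable selection: a Borel subset of a product of standard Borel spaces with almost all
sections nonempty contains the graph of a measurable function, up to a null set. -/
theorem exists_measurable_ae_selection {X Y : Type*} [MeasurableSpace X] [StandardBorelSpace X]
    [MeasurableSpace Y] [StandardBorelSpace Y] [Nonempty Y] (m : Measure X) [IsFiniteMeasure m]
    {D : Set (X × Y)} (hD : MeasurableSet D) (h : ∀ᵐ x ∂m, ∃ y, (x, y) ∈ D) :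
    ∃ s : X → Y, Measurable s ∧ ∀ᵐ x ∂m, (x, s x) ∈ D := by
  let := upgradeStandardBorel X
  let := upgradeStandardBorel Y
  have hA := hD.analyticSet
  rw [AnalyticSet] at hA
  rcases hA with rfl | ⟨f, hf, hfD⟩
  · exact ⟨fun _ => Classical.arbitrary Y, measurable_const, by simpa using h⟩
  obtain ⟨t, ht, hgt⟩ := exists_measurable_ae_rightInverse m (continuous_fst.comp hf) (by
    filter_upwards [h] with x hx
    obtain ⟨y, hy⟩ := hx
    rw [← hfD] at hy
    obtain ⟨s, hs⟩ := hy
    exact ⟨s, by simp [hs]⟩)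
  refine ⟨fun x => (f (t x)).2, measurable_snd.comp (hf.measurable.comp ht), ?_⟩
  filter_upwards [hgt] with x hx
  rw [← hfD]
  exact ⟨t x, Prod.ext hx rfl⟩

/-! ### Jensen's inequality for extended nonnegative convex functions -/

section Jensen

variable {α : ℝ≥0∞ → ℝ≥0∞}

lemma convexOn_chord_le (hc : ConvexOn ℝ≥0 Set.univ α) {u m v : ℝ≥0} (hum : u ≤ m) (hmv : m ≤ v)
    (huv : u < v) :
    ((v - u : ℝ≥0) : ℝ≥0∞) * α m ≤ ((v - m : ℝ≥0) : ℝ≥0∞) * α u + ((m - u : ℝ≥0) : ℝ≥0∞) * α v := by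
  obtain ⟨x, rfl⟩ := exists_add_of_le hum
  obtain ⟨y, rfl⟩ := exists_add_of_le hmv
  have e1 : u + x + y - u = x + y := by rw [add_assoc, add_tsub_cancel_left]
  have e2 : u + x + y - (u + x) = y := add_tsub_cancel_left _ _
  have e3 : u + x - u = x := add_tsub_cancel_left _ _
  rw [e1, e2, e3]
  have hxy : x + y ≠ 0 := by
    intro h
    rw [add_assoc, h, add_zero] at huv
    exact lt_irrefl _ huv
  have h := hc.2 (mem_univ (u : ℝ≥0∞)) (mem_univ ((u + x + y : ℝ≥0) : ℝ≥0∞))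
    (zero_le (a := y / (x + y))) (zero_le (a := x / (x + y)))
    (by rw [← add_div, add_comm y x, div_self hxy])
  have hpt : (y / (x + y)) • (u : ℝ≥0∞) + (x / (x + y)) • ((u + x + y : ℝ≥0) : ℝ≥0∞)
      = ((u + x : ℝ≥0) : ℝ≥0∞) := by
    rw [ENNReal.smul_def, ENNReal.smul_def, smul_eq_mul, smul_eq_mul, ← ENNReal.coe_mul,
      ← ENNReal.coe_mul, ← ENNReal.coe_add]
    congr 1
    field_simp
    ring
  rw [hpt, ENNReal.smul_def, ENNReal.smul_def, smul_eq_mul, smul_eq_mul] at h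
  calc ((x + y : ℝ≥0) : ℝ≥0∞) * α ((u + x : ℝ≥0) : ℝ≥0∞)
      ≤ ((x + y : ℝ≥0) : ℝ≥0∞) * (((y / (x + y) : ℝ≥0) : ℝ≥0∞) * α u +
          ((x / (x + y) : ℝ≥0) : ℝ≥0∞) * α ((u + x + y : ℝ≥0) : ℝ≥0∞)) := by gcongr
    _ = _ := by
      rw [mul_add, ← mul_assoc, ← mul_assoc, ← ENNReal.coe_mul, ← ENNReal.coe_mul,
        mul_div_cancel₀ _ hxy, mul_div_cancel₀ _ hxy]

/-- Slopes of a nondecreasing convex function increase. Truncated subtraction is harmless here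
because `α` is monotone. -/
lemma slope_le_slope_of_convexOn (hc : ConvexOn ℝ≥0 Set.univ α) (hα : Monotone α) {u m v : ℝ≥0}
    (hum : u < m) (hmv : m < v) (hm : α m ≠ ⊤) :
    (α m - α u) / ((m - u : ℝ≥0) : ℝ≥0∞) ≤ (α v - α m) / ((v - m : ℝ≥0) : ℝ≥0∞) := by
  rcases eq_or_ne (α v) ⊤ with hv | hv
  · rw [hv, ENNReal.top_sub hm, ENNReal.top_div_of_ne_top ENNReal.coe_ne_top]
    exact le_top
  have h1 : α u ≤ α m := hα (by exact_mod_cast hum.le)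
  have h2 : α m ≤ α v := hα (by exact_mod_cast hmv.le)
  have hu : α u ≠ ⊤ := ne_top_of_le_ne_top hm h1
  have chord := convexOn_chord_le hc hum.le hmv.le (hum.trans hmv)
  obtain ⟨x, rfl⟩ := exists_add_of_le hum.le
  obtain ⟨y, rfl⟩ := exists_add_of_le hmv.le
  have hx : x ≠ 0 := by rintro rfl; simp at hum
  have hy : y ≠ 0 := by rintro rfl; simp at hmv
  rw [add_assoc, add_tsub_cancel_left, ← add_assoc, add_tsub_cancel_left, add_tsub_cancel_left]
    at chord
  rw [add_tsub_cancel_left, add_tsub_cancel_left]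
  obtain ⟨p, hp⟩ : ∃ r : ℝ≥0, (r : ℝ≥0∞) = _ := ⟨_, ENNReal.coe_toNNReal hu⟩
  obtain ⟨q, hq⟩ : ∃ r : ℝ≥0, (r : ℝ≥0∞) = _ := ⟨_, ENNReal.coe_toNNReal hm⟩
  obtain ⟨r, hr⟩ : ∃ r : ℝ≥0, (r : ℝ≥0∞) = _ := ⟨_, ENNReal.coe_toNNReal hv⟩
  rw [← hp, ← hq] at h1
  rw [← hq, ← hr] at h2
  rw [← hp, ← hq, ← hr] at chord
  rw [← hp, ← hq, ← hr, ← ENNReal.coe_sub, ← ENNReal.coe_sub, ← ENNReal.coe_div hx,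
    ← ENNReal.coe_div hy]
  norm_cast at chord h1 h2 ⊢
  obtain ⟨d, rfl⟩ := exists_add_of_le h1
  obtain ⟨e, rfl⟩ := exists_add_of_le h2
  rw [add_tsub_cancel_left, add_tsub_cancel_left, div_le_div_iff₀ (pos_iff_ne_zero.2 hx)
    (pos_iff_ne_zero.2 hy)]
  rw [← NNReal.coe_le_coe] at chord ⊢
  push_cast at chord ⊢
  linarith

/-- A nondecreasing convex function has a supporting line of finite slope at each point `m` that
is not the right end of its domain. -/
lemma exists_supporting_line (hc : ConvexOn ℝ≥0 Set.univ α) (hα : Monotone α) {m w : ℝ≥0}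
    (hmw : m < w) (hw : α w ≠ ⊤) :
    ∃ s : ℝ≥0, ∀ u : ℝ≥0∞, α m + s * u ≤ α u + s * m := by
  have hm : α m ≠ ⊤ := ne_top_of_le_ne_top hw (hα (by exact_mod_cast hmw.le))
  -- the left derivative of `α` at `m`
  let s : ℝ≥0∞ := ⨆ (u : ℝ≥0) (_ : u < m), (α m - α u) / ((m - u : ℝ≥0) : ℝ≥0∞)
  have hs : ∀ v : ℝ≥0, m < v → s ≤ (α v - α m) / ((v - m : ℝ≥0) : ℝ≥0∞) := fun v hv =>
    iSup₂_le fun u hu => slope_le_slope_of_convexOn hc hα hu hv hm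
  have hs_top : s ≠ ⊤ := by
    refine ne_top_of_le_ne_top (ENNReal.div_ne_top (ne_top_of_le_ne_top hw tsub_le_self) ?_)
      (hs w hmw)
    exact_mod_cast (tsub_pos_of_lt hmw).ne'
  obtain ⟨t, ht⟩ : ∃ r : ℝ≥0, (r : ℝ≥0∞) = _ := ⟨_, ENNReal.coe_toNNReal hs_top⟩
  have hfin : ∀ u : ℝ≥0, α m + t * u ≤ α u + t * m := by
    intro u
    rcases lt_trichotomy u m with hu | rfl | hu
    · have h1 : (α m - α u) / ((m - u : ℝ≥0) : ℝ≥0∞) ≤ t := by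
        rw [ht]; exact le_iSup₂ (f := fun (u : ℝ≥0) (_ : u < m) =>
          (α m - α u) / ((m - u : ℝ≥0) : ℝ≥0∞)) u hu
      rw [ENNReal.div_le_iff (by exact_mod_cast (tsub_pos_of_lt hu).ne') ENNReal.coe_ne_top,
        tsub_le_iff_left] at h1
      calc α m + t * u ≤ α u + t * ((m - u : ℝ≥0) : ℝ≥0∞) + t * u := by gcongr
        _ = α u + t * m := by
          rw [add_assoc, ← mul_add, ← ENNReal.coe_add, tsub_add_cancel_of_le hu.le]
    · exact le_rfl
    · have h1 := hs u hu
      rw [← ht, ENNReal.le_div_iff_mul_le (Or.inl (by exact_mod_cast (tsub_pos_of_lt hu).ne'))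
        (Or.inl ENNReal.coe_ne_top)] at h1
      have hmu : α m ≤ α u := hα (by exact_mod_cast hu.le)
      calc α m + t * u = α m + t * ((u - m : ℝ≥0) : ℝ≥0∞) + t * m := by
            rw [add_assoc, ← mul_add, ← ENNReal.coe_add, tsub_add_cancel_of_le hu.le]
        _ ≤ α m + (α u - α m) + t * m := by gcongr
        _ = α u + t * m := by rw [add_tsub_cancel_of_le hmu]
  refine ⟨t, fun u => ?_⟩
  induction u with
  | coe u => exact hfin u
  | top =>
    have h1 : ∀ u : ℝ≥0, α m + t * u ≤ α ⊤ + t * m := fun u =>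
      (hfin u).trans (by gcongr; exact hα le_top)
    have hlim : Filter.Tendsto (fun n : ℕ => α m + t * ((n : ℝ≥0) : ℝ≥0∞)) Filter.atTop
        (𝓝 (α m + t * ⊤)) := by
      refine Filter.Tendsto.const_add _ (ENNReal.Tendsto.const_mul ?_ (Or.inl ENNReal.top_ne_zero))
      exact ENNReal.tendsto_nat_nhds_top
    exact le_of_tendsto' hlim fun n => h1 n

/-- A nonconstant nondecreasing convex function that is continuous at `∞` grows at least
linearly on its domain. -/
lemma exists_linear_lower_bound (hc : ConvexOn ℝ≥0 Set.univ α) (hα : Monotone α)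
    (htop : ContinuousAt α ⊤) (hne : α 0 < α ⊤) :
    ∃ s b : ℝ≥0, s ≠ 0 ∧ ∀ u : ℝ≥0∞, s * u ≤ α u + b := by
  -- Continuity at `∞` provides a finite point `w` with `α 0 < α w`.
  obtain ⟨w, hw⟩ : ∃ w : ℝ≥0, α 0 < α w := by
    have h1 : Filter.Tendsto (fun n : ℕ => α n) Filter.atTop (𝓝 (α ⊤)) :=
      htop.tendsto.comp ENNReal.tendsto_nat_nhds_top
    obtain ⟨n, hn⟩ := (h1.eventually (lt_mem_nhds hne)).exists
    exact ⟨n, by simpa using hn⟩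
  have hw0 : 0 < w := by
    rw [pos_iff_ne_zero]; rintro rfl; simp at hw
  obtain ⟨d, hd0, hd⟩ : ∃ d : ℝ≥0, d ≠ 0 ∧ α 0 + d ≤ α w := by
    obtain ⟨r, hr, hrw⟩ := ENNReal.lt_iff_exists_nnreal_btwn.1 hw
    obtain ⟨p, hp⟩ : ∃ r : ℝ≥0, (r : ℝ≥0∞) = _ := ⟨_, ENNReal.coe_toNNReal (ne_top_of_lt hr)⟩
    rw [← hp] at hr ⊢
    have hpr : p < r := by exact_mod_cast hr
    refine ⟨r - p, (tsub_pos_of_lt hpr).ne', ?_⟩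
    rw [← ENNReal.coe_add, add_tsub_cancel_of_le hpr.le]
    exact hrw.le
  have h0 : α 0 ≠ ⊤ := ne_top_of_lt hw
  have hfin : ∀ u : ℝ≥0, ((d / w : ℝ≥0) : ℝ≥0∞) * u ≤ α u + d := by
    intro u
    rcases le_or_gt u w with hu | hu
    · calc ((d / w : ℝ≥0) : ℝ≥0∞) * u ≤ ((d / w : ℝ≥0) : ℝ≥0∞) * w := by gcongr
        _ = d := by rw [← ENNReal.coe_mul, div_mul_cancel₀ _ hw0.ne']
        _ ≤ α u + d := le_add_self
    · have chord := convexOn_chord_le hc (zero_le (a := w)) hu.le (hw0.trans hu)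
      simp only [tsub_zero, ENNReal.coe_zero] at chord
      have hu0 : ((u - w : ℝ≥0) : ℝ≥0∞) * α 0 ≠ ⊤ := ENNReal.mul_ne_top ENNReal.coe_ne_top h0
      have h2 : (u : ℝ≥0∞) * d ≤ w * α u := by
        have h3 : ((u - w : ℝ≥0) : ℝ≥0∞) * α 0 + u * d ≤
            ((u - w : ℝ≥0) : ℝ≥0∞) * α 0 + w * α u := by
          calc ((u - w : ℝ≥0) : ℝ≥0∞) * α 0 + u * d ≤ u * α 0 + u * d := by
                gcongr; exact tsub_le_self
            _ = u * (α 0 + d) := by rw [mul_add]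
            _ ≤ u * α w := by gcongr
            _ ≤ _ := chord
        exact (ENNReal.add_le_add_iff_left hu0).1 h3
      rw [← ENNReal.coe_mul, show d / w * u = u * d / w by ring, ENNReal.coe_div hw0.ne',
        ENNReal.coe_mul]
      exact (ENNReal.div_le_of_le_mul' h2).trans le_self_add
  refine ⟨d / w, d, (div_pos (pos_iff_ne_zero.2 hd0) hw0).ne', fun u => ?_⟩
  induction u with
  | coe u => exact hfin u
  | top =>
    have hlim : Filter.Tendsto (fun n : ℕ => ((d / w : ℝ≥0) : ℝ≥0∞) * ((n : ℝ≥0) : ℝ≥0∞))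
        Filter.atTop (𝓝 (((d / w : ℝ≥0) : ℝ≥0∞) * ⊤)) :=
      ENNReal.Tendsto.const_mul ENNReal.tendsto_nat_nhds_top (Or.inl ENNReal.top_ne_zero)
    exact le_of_tendsto' hlim fun n => (hfin n).trans (by gcongr; exact hα le_top)

/-- Jensen's inequality. The function `α` need not be lower semicontinuous at the right end of its
domain. -/
lemma map_lintegral_le_lintegral_of_measurable (hc : ConvexOn ℝ≥0 Set.univ α) (hα : Monotone α)
    (htop : ContinuousAt α ⊤) {Ω : Type*} [MeasurableSpace Ω] (P : Measure Ω)
    [IsProbabilityMeasure P] {h : Ω → ℝ≥0∞} (hh : Measurable h) :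
    α (∫⁻ ω, h ω ∂P) ≤ ∫⁻ ω, α (h ω) ∂P := by
  have hαh : Measurable fun ω => α (h ω) := hα.measurable.comp hh
  rcases eq_or_ne (∫⁻ ω, α (h ω) ∂P) ⊤ with hI | hI
  · rw [hI]; exact le_top
  have hfin : ∀ᵐ ω ∂P, α (h ω) < ⊤ := ae_lt_top hαh hI
  rcases eq_or_ne (∫⁻ ω, h ω ∂P) ⊤ with hm | hm
  · rw [hm]
    rcases (hα (zero_le (a := (⊤ : ℝ≥0∞)))).lt_or_eq with hlt | heq
    · obtain ⟨s, b, hs, hsb⟩ := exists_linear_lower_bound hc hα htop hlt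
      have h1 : ∫⁻ ω, s * h ω ∂P ≤ ∫⁻ ω, α (h ω) + b ∂P := lintegral_mono fun ω => hsb _
      rw [lintegral_const_mul _ hh, hm, lintegral_add_right _ measurable_const,
        ENNReal.mul_top (by exact_mod_cast hs), top_le_iff] at h1
      simp [hI] at h1
    · calc α ⊤ = ∫⁻ _, α 0 ∂P := by simp [heq]
        _ ≤ _ := lintegral_mono fun ω => hα (zero_le)
  obtain ⟨m, hm'⟩ : ∃ r : ℝ≥0, (r : ℝ≥0∞) = _ := ⟨_, ENNReal.coe_toNNReal hm⟩
  by_cases hle : ∀ᵐ ω ∂P, h ω ≤ m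
  · -- then `h` is almost surely equal to its mean
    have hint : ∫⁻ ω, h ω ∂P = ∫⁻ _, (m : ℝ≥0∞) ∂P := by simp [hm']
    have heq := ae_eq_of_ae_le_of_lintegral_le hle hm measurable_const.aemeasurable hint.ge
    rw [← hm', lintegral_congr_ae (g := fun _ => α m)]
    · simp
    · filter_upwards [heq] with ω hω
      rw [hω]
  · obtain ⟨ω, hω, hωm⟩ : ∃ ω, α (h ω) < ⊤ ∧ m < h ω := by
      by_contra! hcon
      exact hle (by filter_upwards [hfin] with ω hω using hcon ω hω)
    obtain ⟨w, hmw, hw⟩ := ENNReal.lt_iff_exists_nnreal_btwn.1 hωm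
    obtain ⟨s, hs⟩ := exists_supporting_line hc hα (m := m) (w := w) (by exact_mod_cast hmw)
      (ne_top_of_le_ne_top hω.ne (hα hw.le))
    have h1 : ∫⁻ ω, α m + s * h ω ∂P ≤ ∫⁻ ω, α (h ω) + s * m ∂P := lintegral_mono fun ω => hs _
    rw [lintegral_add_left measurable_const, lintegral_const_mul _ hh, ← hm',
      lintegral_add_right _ measurable_const] at h1
    simp only [lintegral_const, measure_univ, mul_one] at h1
    rw [← hm']
    exact (ENNReal.add_le_add_iff_right
      (ENNReal.mul_ne_top ENNReal.coe_ne_top ENNReal.coe_ne_top)).1 h1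

/-- Jensen's inequality for an arbitrary integrand, the integrals being lower integrals. -/
theorem map_lintegral_le_lintegral (hc : ConvexOn ℝ≥0 Set.univ α) (hα : Monotone α)
    (htop : ContinuousAt α ⊤) {Ω : Type*} [MeasurableSpace Ω] (P : Measure Ω)
    [IsProbabilityMeasure P] (h : Ω → ℝ≥0∞) :
    α (∫⁻ ω, h ω ∂P) ≤ ∫⁻ ω, α (h ω) ∂P := by
  obtain ⟨g, hg, hgh, hint⟩ := exists_measurable_le_lintegral_eq P h
  rw [hint]
  exact (map_lintegral_le_lintegral_of_measurable hc hα htop P hg).trans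
    (lintegral_mono fun ω => hα (hgh ω))

end Jensen

/-! ### Measurable selection of couplings -/

section Selection

/-- The probability measures on a standard Borel space are parametrized by a Markov kernel from
`ℚ → ℝ`: on the real line a point of `ℚ → ℝ` is read as the restriction of a distribution function
to the rationals. -/
lemma exists_kernel_surjective_probabilityMeasure (Ω : Type*) [MeasurableSpace Ω]
    [StandardBorelSpace Ω] [Nonempty Ω] :
    ∃ Λ : Kernel (ℚ → ℝ) Ω, IsMarkovKernel Λ ∧
      ∀ P : Measure Ω, IsProbabilityMeasure P → ∃ y, Λ y = P := by
  let F := stieltjesOfMeasurableRat (id : (ℚ → ℝ) → ℚ → ℝ) measurable_id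
  let K : Kernel (ℚ → ℝ) ℝ :=
    ⟨fun y => (F y).measure, measurable_measure_stieltjesOfMeasurableRat measurable_id⟩
  have hK : IsMarkovKernel K :=
    ⟨fun y => instIsProbabilityMeasure_stieltjesOfMeasurableRat measurable_id y⟩
  have hsurj : ∀ P : Measure ℝ, IsProbabilityMeasure P → ∃ y, K y = P := by
    intro P hP
    refine ⟨fun q => cdf P q, ?_⟩
    have hpt : IsRatStieltjesPoint (id : (ℚ → ℝ) → ℚ → ℝ) (fun q => cdf P q) := by
      refine ⟨fun a b hab => monotone_cdf P (by exact_mod_cast hab),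
        (tendsto_cdf_atTop P).comp (tendsto_ratCast_atTop_iff.2 Filter.tendsto_id),
        (tendsto_cdf_atBot P).comp (tendsto_ratCast_atBot_iff.2 Filter.tendsto_id), fun t => ?_⟩
      rw [id, ← (cdf P).iInf_rat_gt_eq t]
      refine Equiv.iInf_congr (Equiv.subtypeEquivRight fun r => ?_) fun r => rfl
      simp
    refine ext_of_generate_finite _ Real.borel_eq_generateFrom_Iic_rat Real.isPiSystem_Iic_rat ?_
      (by simp)
    intro s hs
    obtain ⟨q, rfl⟩ : ∃ q : ℚ, Iic (q : ℝ) = s := by simpa [eq_comm] using hs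
    change (F _).measure _ = _
    rw [measure_stieltjesOfMeasurableRat_Iic, stieltjesOfMeasurableRat_eq,
      toRatCDF_of_isRatStieltjesPoint hpt, id, ofReal_cdf]
  obtain ⟨g, hg, hge⟩ := (measurableEmbedding_embeddingReal Ω).exists_measurable_extend
    measurable_id fun _ => inferInstance
  refine ⟨K.map g, Kernel.IsMarkovKernel.map K hg, fun P hP => ?_⟩
  have he := (measurableEmbedding_embeddingReal Ω).measurable
  obtain ⟨y, hy⟩ := hsurj (P.map (embeddingReal Ω)) (Measure.isProbabilityMeasure_map he.aemeasurable)
  exact ⟨y, by rw [Kernel.map_apply _ hg, hy, Measure.map_map hg he, hge, Measure.map_id]⟩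

lemma measurableSet_kernel_eq {γ E : Type*} [MeasurableSpace γ] [MeasurableSpace E]
    [MeasurableSpace.CountableOrCountablyGenerated γ E] (κ η : Kernel γ E) [IsFiniteKernel κ]
    [IsFiniteKernel η] : MeasurableSet {a | κ a = η a} := by
  have hset : MeasurableSet {p : γ × E | κ.rnDeriv η p.1 p.2 ≠ 1} :=
    (measurableSet_eq_fun (Kernel.measurable_rnDeriv κ η) measurable_const).compl
  have : {a | κ a = η a} = {a | κ a ≪ η a} ∩
      {a | η a (Prod.mk a ⁻¹' {p : γ × E | κ.rnDeriv η p.1 p.2 ≠ 1}) = 0} := by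
    ext a
    refine ⟨fun h => ?_, fun h => ?_⟩
    · have hac : κ a ≪ η a := by
        rw [show κ a = η a from h]
      exact ⟨hac, (Kernel.rnDeriv_eq_one_iff_eq hac).2 h⟩
    · exact (Kernel.rnDeriv_eq_one_iff_eq h.1).1 h.2
  rw [this]
  exact (Kernel.measurableSet_absolutelyContinuous κ η).inter
    (measurableSet_eq_fun (Kernel.measurable_kernel_prodMk_left hset) measurable_const)

variable {E : Type*} [MeasurableSpace E] {ι : Type*} [Fintype ι]

/-- The Marton-type cost `c(x, p) = ∑ i, α (∫ ρ i x y p(dy))` of a finite family `ρ` of ground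
costs. -/
def familyCost (α : ℝ≥0∞ → ℝ≥0∞) (ρ : ι → E → E → ℝ≥0∞) (x : E) (p : Measure E) : ℝ≥0∞ :=
  ∑ i, α (∫⁻ y, ρ i x y ∂p)

lemma measurable_familyCost {α : ℝ≥0∞ → ℝ≥0∞} (hα : Measurable α) {ρ : ι → E → E → ℝ≥0∞}
    (hρ : ∀ i, Measurable (Function.uncurry (ρ i))) {γ : Type*} [MeasurableSpace γ]
    (K : Kernel γ E) [IsSFiniteKernel K] {f : γ → E} (hf : Measurable f) :
    Measurable fun z => familyCost α ρ (f z) (K z) := by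
  unfold familyCost
  refine Finset.measurable_fun_sum _ fun i _ => hα.comp ?_
  exact Measurable.lintegral_kernel_prod_right (f := fun z y => ρ i (f z) y)
    ((hρ i).comp ((hf.comp measurable_fst).prodMk measurable_snd))

/-- Given measurable families `κ₁`, `κ₂` of probability measures such that for almost every
parameter `w` some coupling of `κ₁ w` and `κ₂ w` has cost at most `h w`, the couplings can be
chosen measurably in `w`. -/
theorem exists_measurable_couplings [StandardBorelSpace E] [Nonempty E] {W : Type*}
    [MeasurableSpace W] [StandardBorelSpace W] (m : Measure W) [IsFiniteMeasure m]
    {α : ℝ≥0∞ → ℝ≥0∞} (hα : Measurable α) {ρ : ι → E → E → ℝ≥0∞}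
    (hρ : ∀ i, Measurable (Function.uncurry (ρ i)))
    (κ₁ κ₂ : Kernel W E) [IsMarkovKernel κ₁] [IsMarkovKernel κ₂] {h : W → ℝ≥0∞} (hh : Measurable h)
    (hex : ∀ᵐ w ∂m, ∃ p : Kernel E E, IsMarkovKernel p ∧ (κ₁ w).bind p = κ₂ w ∧
      ∫⁻ x, familyCost α ρ x (p x) ∂κ₁ w ≤ h w) :
    ∃ q : Kernel (W × E) E, IsMarkovKernel q ∧ ∀ᵐ w ∂m, (κ₁ w).bind (fun x => q (w, x)) = κ₂ w ∧
      ∫⁻ x, familyCost α ρ x (q (w, x)) ∂κ₁ w ≤ h w := by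
  obtain ⟨Λ, hΛ, hsurj⟩ := exists_kernel_surjective_probabilityMeasure (E × E)
  let G : (ℚ → ℝ) → ℝ≥0∞ := fun y => ∫⁻ x, familyCost α ρ x (Λ.condKernel (y, x)) ∂(Λ.fst y)
  have hG : Measurable G := Measurable.lintegral_kernel_prod_right
    (f := fun y x => familyCost α ρ x (Λ.condKernel (y, x)))
    (measurable_familyCost hα hρ Λ.condKernel measurable_snd)
  have hdis : ∀ y, Λ y = Λ.fst y ⊗ₘ Λ.condKernel.sectR y := by
    intro y
    conv_lhs => rw [← Λ.disintegrate Λ.condKernel]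
    exact Kernel.compProd_apply_eq_compProd_sectR _ _ _
  let D : Set (W × (ℚ → ℝ)) := {z | Λ.fst z.2 = κ₁ z.1 ∧ Λ.snd z.2 = κ₂ z.1 ∧ G z.2 ≤ h z.1}
  have hD : MeasurableSet D := by
    have h1 := measurableSet_kernel_eq (Λ.fst.comap (Prod.snd : W × (ℚ → ℝ) → _) measurable_snd)
      (κ₁.comap Prod.fst measurable_fst)
    have h2 := measurableSet_kernel_eq (Λ.snd.comap (Prod.snd : W × (ℚ → ℝ) → _) measurable_snd)
      (κ₂.comap Prod.fst measurable_fst)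
    have h3 := measurableSet_le (hG.comp (measurable_snd (α := W) (β := ℚ → ℝ)))
      (hh.comp measurable_fst)
    exact h1.inter (h2.inter h3)
  obtain ⟨s, hs, hsD⟩ := exists_measurable_ae_selection m hD (by
    filter_upwards [hex] with w hw
    obtain ⟨p, hp, hpb, hpc⟩ := hw
    obtain ⟨y, hy⟩ := hsurj (κ₁ w ⊗ₘ p) inferInstance
    have hfst : Λ.fst y = κ₁ w := by rw [Kernel.fst_apply, hy]; exact Measure.fst_compProd _ _
    refine ⟨y, hfst, ?_, ?_⟩
    · rw [Kernel.snd_apply, hy, ← hpb]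
      exact Measure.snd_compProd _ _
    · have e : κ₁ w ⊗ₘ Λ.condKernel.sectR y = κ₁ w ⊗ₘ p := by rw [← hy, ← hfst, ← hdis]
      refine le_trans (le_of_eq ?_) hpc
      change ∫⁻ x, familyCost α ρ x (Λ.condKernel (y, x)) ∂(Λ.fst y) = _
      rw [hfst]
      refine lintegral_congr_ae ?_
      filter_upwards [Kernel.ae_eq_of_compProd_eq e] with x hx
      rw [← hx, Kernel.sectR_apply])
  refine ⟨Λ.condKernel.comap (fun z : W × E => (s z.1, z.2)) (by fun_prop), inferInstance, ?_⟩
  filter_upwards [hsD] with w hw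
  obtain ⟨h1, h2, h3⟩ := hw
  dsimp only at h1 h2 h3
  simp only [Kernel.comap_apply]
  refine ⟨?_, ?_⟩
  · rw [← h2, ← h1, Kernel.snd_apply, hdis (s w)]
    exact (Measure.snd_compProd (Λ.fst (s w)) (Λ.condKernel.sectR (s w))).symm
  · rw [← h1]
    exact h3

end Selection

/-! ### Tensorization of the transport-entropy inequality -/

section Tensorization

open InformationTheory

/-- Chain rule for the relative entropy with respect to a product measure. The conditional entropy
`x ↦ H(ν(· | x) | μ₂)` is replaced by a measurable version. -/
lemma exists_measurable_klDiv_condKernel {E₁ E₂ : Type*} [MeasurableSpace E₁] [MeasurableSpace E₂]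
    [StandardBorelSpace E₂] [Nonempty E₂] (ν : Measure (E₁ × E₂)) [IsProbabilityMeasure ν]
    (μ₁ : Measure E₁) (μ₂ : Measure E₂) [IsProbabilityMeasure μ₁] [IsProbabilityMeasure μ₂]
    (hfin : klDiv ν (μ₁.prod μ₂) ≠ ⊤) :
    ∃ h : E₁ → ℝ≥0∞, Measurable h ∧ (∀ᵐ x ∂ν.fst, h x = klDiv (ν.condKernel x) μ₂) ∧
      klDiv ν (μ₁.prod μ₂) = klDiv ν.fst μ₁ + ∫⁻ x, h x ∂ν.fst := by
  let κ := ν.condKernel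
  let η : Kernel E₁ E₂ := Kernel.const E₁ μ₂
  have hchain : klDiv ν (μ₁.prod μ₂)
      = klDiv ν.fst μ₁ + klDiv (ν.fst ⊗ₘ κ) (ν.fst ⊗ₘ η) := by
    conv_lhs => rw [← ν.disintegrate κ, ← Measure.compProd_const]
    exact klDiv_compProd_eq_add _ _ _ _
  have hfin2 : klDiv (ν.fst ⊗ₘ κ) (ν.fst ⊗ₘ η) ≠ ⊤ := fun h => hfin (by rw [hchain, h, add_top])
  have hac : ν.fst ⊗ₘ κ ≪ ν.fst ⊗ₘ η := (klDiv_ne_top_iff.1 hfin2).1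
  have hacx : ∀ᵐ x ∂ν.fst, κ x ≪ η x := hac.kernel_of_compProd
  let f : E₁ → E₂ → ℝ≥0∞ := κ.rnDeriv η
  have hf : Measurable (Function.uncurry f) := Kernel.measurable_rnDeriv κ η
  have hphi : Measurable fun z : E₁ × E₂ => ENNReal.ofReal (klFun (f z.1 z.2).toReal) :=
    (measurable_klFun.comp hf.ennreal_toReal).ennreal_ofReal
  refine ⟨fun x => ∫⁻ y, ENNReal.ofReal (klFun (f x y).toReal) ∂μ₂,
    hphi.lintegral_prod_right', ?_, ?_⟩
  · filter_upwards [hacx] with x hx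
    rw [klDiv_eq_lintegral_klFun_of_ac (μ := ν.condKernel x) (ν := μ₂) hx]
    refine lintegral_congr_ae ?_
    have h1 : κ.rnDeriv η x =ᵐ[η x] (κ x).rnDeriv (η x) := Kernel.rnDeriv_eq_rnDeriv_measure
    filter_upwards [h1] with y hy
    rw [show f x y = (ν.condKernel x).rnDeriv μ₂ y from hy]
  · rw [hchain, klDiv_eq_lintegral_klFun_of_ac hac]
    congr 1
    have hdens : ν.fst ⊗ₘ κ = (ν.fst ⊗ₘ η).withDensity (Function.uncurry f) := by
      have hκ : κ =ᵐ[ν.fst] η.withDensity f := by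
        filter_upwards [hacx] with x hx
        exact (Kernel.withDensity_rnDeriv_eq hx).symm
      rw [Measure.compProd_congr hκ]
      exact Measure.compProd_withDensity hf
    have hrn : (ν.fst ⊗ₘ κ).rnDeriv (ν.fst ⊗ₘ η) =ᵐ[ν.fst ⊗ₘ η] Function.uncurry f := by
      rw [hdens]
      exact Measure.rnDeriv_withDensity _ hf
    calc _ = ∫⁻ z, ENNReal.ofReal (klFun (f z.1 z.2).toReal) ∂(ν.fst ⊗ₘ η) := by
          refine lintegral_congr_ae ?_
          filter_upwards [hrn] with z hz
          rw [hz, Function.uncurry]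
      _ = _ := by rw [Measure.lintegral_compProd hphi]; rfl

/-- Transport-entropy inequality for the cost of a family of ground costs, in terms of almost
optimal coupling kernels. -/
def HasEntropyCouplings {E : Type*} [MeasurableSpace E] {ι : Type*} [Fintype ι]
    (α : ℝ≥0∞ → ℝ≥0∞) (ρ : ι → E → E → ℝ≥0∞) (γ : Measure E) (a₁ a₂ : ℝ≥0∞) : Prop :=
  ∀ ν₁ ν₂ : Measure E, IsProbabilityMeasure ν₁ → IsProbabilityMeasure ν₂ →
    ∀ ε : ℝ≥0∞, ε ≠ 0 → ∃ p : Kernel E E, IsMarkovKernel p ∧ ν₁.bind p = ν₂ ∧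
      ∫⁻ x, familyCost α ρ x (p x) ∂ν₁ ≤ a₁ * klDiv ν₁ γ + a₂ * klDiv ν₂ γ + ε

lemma lintegral_condKernel_swap {E₁ E₂ F : Type*} [MeasurableSpace E₁] [MeasurableSpace E₂]
    [MeasurableSpace F] [StandardBorelSpace E₂] [Nonempty E₂] (ν : Measure (E₁ × E₂))
    [IsProbabilityMeasure ν] (p : Kernel E₁ F) [IsMarkovKernel p] {f : (E₁ × F) × E₂ → ℝ≥0∞}
    (hf : Measurable f) :
    ∫⁻ x, ∫⁻ y, f ((x.1, y), x.2) ∂p x.1 ∂ν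
      = ∫⁻ w, ∫⁻ x₂, f (w, x₂) ∂ν.condKernel w.1 ∂(ν.fst ⊗ₘ p) := by
  have h1 : Measurable fun x : E₁ × E₂ => ∫⁻ y, f ((x.1, y), x.2) ∂p x.1 :=
    Measurable.lintegral_kernel_prod_right (κ := p.comap Prod.fst measurable_fst)
      (f := fun (x : E₁ × E₂) y => f ((x.1, y), x.2)) (hf.comp (by fun_prop))
  have h2 : Measurable fun w : E₁ × F => ∫⁻ x₂, f (w, x₂) ∂ν.condKernel w.1 :=
    Measurable.lintegral_kernel_prod_right (κ := ν.condKernel.comap Prod.fst measurable_fst)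
      (f := fun (w : E₁ × F) x₂ => f (w, x₂)) hf
  conv_lhs => rw [← ν.disintegrate ν.condKernel]
  rw [Measure.lintegral_compProd h1, Measure.lintegral_compProd h2]
  refine lintegral_congr fun x₁ => ?_
  have hs : Measurable fun z : E₂ × F => f ((x₁, z.2), z.1) := hf.comp (by fun_prop)
  exact lintegral_lintegral_swap (μ := ν.condKernel x₁) (ν := p x₁)
    (f := fun x₂ y => f ((x₁, y), x₂)) hs.aemeasurable

/-- Tensorization: given good couplings of the first marginals, couple the conditional laws of the
second coordinate by a measurable selection, and glue. The cost of the glued coupling is controlled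
by Jensen's inequality. -/
theorem HasEntropyCouplings.prod {E₁ E₂ : Type*} [MeasurableSpace E₁] [MeasurableSpace E₂]
    [StandardBorelSpace E₁] [StandardBorelSpace E₂] [Nonempty E₁] [Nonempty E₂]
    {ι₁ ι₂ : Type*} [Fintype ι₁] [Fintype ι₂] {α : ℝ≥0∞ → ℝ≥0∞}
    (hc : ConvexOn ℝ≥0 Set.univ α) (hα : Monotone α) (htop : ContinuousAt α ⊤)
    {ρ₁ : ι₁ → E₁ → E₁ → ℝ≥0∞} {ρ₂ : ι₂ → E₂ → E₂ → ℝ≥0∞}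
    (hρ₁ : ∀ i, Measurable (Function.uncurry (ρ₁ i)))
    (hρ₂ : ∀ i, Measurable (Function.uncurry (ρ₂ i)))
    {μ₁ : Measure E₁} {μ₂ : Measure E₂} [IsProbabilityMeasure μ₁] [IsProbabilityMeasure μ₂]
    {a₁ a₂ : ℝ≥0∞} (ha₁ : a₁ ≠ 0) (ha₂ : a₂ ≠ 0)
    (h₁ : HasEntropyCouplings α ρ₁ μ₁ a₁ a₂) (h₂ : HasEntropyCouplings α ρ₂ μ₂ a₁ a₂) :
    HasEntropyCouplings α
      (Sum.elim (fun i (x y : E₁ × E₂) => ρ₁ i x.1 y.1) fun j x y => ρ₂ j x.2 y.2)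
      (μ₁.prod μ₂) a₁ a₂ := by
  intro ν₁ ν₂ hν₁ hν₂ ε hε
  by_cases hfin : klDiv ν₁ (μ₁.prod μ₂) = ⊤ ∨ klDiv ν₂ (μ₁.prod μ₂) = ⊤
  · refine ⟨Kernel.const _ ν₂, inferInstance, ?_, le_of_le_of_eq le_top ?_⟩
    · simp
    · rcases hfin with h | h <;> simp [h, ENNReal.mul_top, ha₁, ha₂]
  push Not at hfin
  obtain ⟨f₁, hf₁, hf₁ae, hchain₁⟩ := exists_measurable_klDiv_condKernel ν₁ μ₁ μ₂ hfin.1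
  obtain ⟨f₂, hf₂, hf₂ae, hchain₂⟩ := exists_measurable_klDiv_condKernel ν₂ μ₁ μ₂ hfin.2
  have hε2 : ε / 2 ≠ 0 := (ENNReal.half_pos hε).ne'
  obtain ⟨p, hp, hpν, hpc⟩ := h₁ ν₁.fst ν₂.fst inferInstance inferInstance (ε / 2) hε2
  let m : Measure (E₁ × E₁) := ν₁.fst ⊗ₘ p
  have hm1 : m.fst = ν₁.fst := Measure.fst_compProd _ _
  have hm2 : m.snd = ν₂.fst := by rw [← hpν]; exact Measure.snd_compProd _ _
  let h : E₁ × E₁ → ℝ≥0∞ := fun w => a₁ * f₁ w.1 + a₂ * f₂ w.2 + ε / 2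
  have hh : Measurable h := by fun_prop
  have hae1 : ∀ᵐ w ∂m, f₁ w.1 = klDiv (ν₁.condKernel w.1) μ₂ :=
    ae_of_ae_map measurable_fst.aemeasurable (by rw [← hm1] at hf₁ae; exact hf₁ae)
  have hae2 : ∀ᵐ w ∂m, f₂ w.2 = klDiv (ν₂.condKernel w.2) μ₂ :=
    ae_of_ae_map measurable_snd.aemeasurable (by rw [← hm2] at hf₂ae; exact hf₂ae)
  obtain ⟨q, hq, hqae⟩ := exists_measurable_couplings m hα.measurable hρ₂
    (ν₁.condKernel.comap Prod.fst measurable_fst) (ν₂.condKernel.comap Prod.snd measurable_snd) hh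
    (by
      filter_upwards [hae1, hae2] with w hw1 hw2
      simp only [Kernel.comap_apply, h, hw1, hw2]
      exact h₂ _ _ inferInstance inferInstance _ hε2)
  simp only [Kernel.comap_apply] at hqae
  let q' : Kernel ((E₁ × E₂) × E₁) E₂ :=
    q.comap (fun z => ((z.1.1, z.2), z.1.2)) (by fun_prop)
  let P : Kernel (E₁ × E₂) (E₁ × E₂) := p.comap Prod.fst measurable_fst ⊗ₖ q'
  have hP : ∀ (x : E₁ × E₂) {f : E₁ × E₂ → ℝ≥0∞}, Measurable f →
      ∫⁻ y, f y ∂P x = ∫⁻ y₁, ∫⁻ y₂, f (y₁, y₂) ∂q ((x.1, y₁), x.2) ∂p x.1 := fun x f hf =>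
    Kernel.lintegral_compProd _ _ _ hf
  refine ⟨P, inferInstance, ?_, ?_⟩
  · refine Measure.ext_of_lintegral _ fun f hf => ?_
    have hF : Measurable fun z : (E₁ × E₁) × E₂ => ∫⁻ y₂, f (z.1.2, y₂) ∂q z :=
      Measurable.lintegral_kernel_prod_right (f := fun (z : (E₁ × E₁) × E₂) y₂ => f (z.1.2, y₂))
        (hf.comp (by fun_prop))
    have hf2 : Measurable fun y₁ => ∫⁻ y₂, f (y₁, y₂) ∂ν₂.condKernel y₁ :=
      Measurable.lintegral_kernel_prod_right hf
    calc ∫⁻ y, f y ∂(ν₁.bind P)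
        = ∫⁻ x, ∫⁻ y₁, ∫⁻ y₂, f (y₁, y₂) ∂q ((x.1, y₁), x.2) ∂p x.1 ∂ν₁ := by
          rw [Measure.lintegral_bind P.aemeasurable hf.aemeasurable]
          exact lintegral_congr fun x => hP x hf
      _ = ∫⁻ w, ∫⁻ x₂, ∫⁻ y₂, f (w.2, y₂) ∂q (w, x₂) ∂ν₁.condKernel w.1 ∂m :=
          lintegral_condKernel_swap ν₁ p hF
      _ = ∫⁻ w, ∫⁻ y₂, f (w.2, y₂) ∂ν₂.condKernel w.2 ∂m := by
          refine lintegral_congr_ae ?_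
          filter_upwards [hqae] with w hw
          rw [← hw.1, Measure.lintegral_bind]
          · exact (q.measurable.comp measurable_prodMk_left).aemeasurable
          · exact (hf.comp measurable_prodMk_left).aemeasurable
      _ = ∫⁻ y₁, ∫⁻ y₂, f (y₁, y₂) ∂ν₂.condKernel y₁ ∂ν₂.fst := by
          rw [← hm2, Measure.snd, lintegral_map hf2 measurable_snd]
      _ = ∫⁻ y, f y ∂ν₂ := by
          conv_rhs => rw [← ν₂.disintegrate ν₂.condKernel]
          rw [Measure.lintegral_compProd hf]
  · have hcost1 : ∀ x : E₁ × E₂, ∀ i, ∫⁻ y, ρ₁ i x.1 y.1 ∂P x = ∫⁻ y₁, ρ₁ i x.1 y₁ ∂p x.1 := by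
      intro x i
      rw [hP x (f := fun y => ρ₁ i x.1 y.1)
        ((hρ₁ i).comp (by fun_prop : Measurable fun y : E₁ × E₂ => (x.1, y.1)))]
      simp
    have hcost2 : ∀ x : E₁ × E₂, ∀ j, α (∫⁻ y, ρ₂ j x.2 y.2 ∂P x)
        ≤ ∫⁻ y₁, α (∫⁻ y₂, ρ₂ j x.2 y₂ ∂q ((x.1, y₁), x.2)) ∂p x.1 := by
      intro x j
      rw [hP x (f := fun y => ρ₂ j x.2 y.2)
        ((hρ₂ j).comp (by fun_prop : Measurable fun y : E₁ × E₂ => (x.2, y.2)))]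
      exact map_lintegral_le_lintegral hc hα htop _ _
    have hmeas2 : ∀ j, Measurable fun z : (E₁ × E₁) × E₂ => α (∫⁻ y₂, ρ₂ j z.2 y₂ ∂q z) := fun j =>
      hα.measurable.comp (Measurable.lintegral_kernel_prod_right
        (f := fun (z : (E₁ × E₁) × E₂) y₂ => ρ₂ j z.2 y₂)
        ((hρ₂ j).comp (by fun_prop :
          Measurable fun z : ((E₁ × E₁) × E₂) × E₂ => (z.1.2, z.2))))
    have hmeasq : Measurable fun z : (E₁ × E₁) × E₂ => familyCost α ρ₂ z.2 (q z) :=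
      measurable_familyCost hα.measurable hρ₂ q measurable_snd
    have hmeasp : Measurable fun x₁ => familyCost α ρ₁ x₁ (p x₁) :=
      measurable_familyCost hα.measurable hρ₁ p measurable_id
    have hpoint : ∀ x : E₁ × E₂, familyCost α
        (Sum.elim (fun i (x y : E₁ × E₂) => ρ₁ i x.1 y.1) fun j x y => ρ₂ j x.2 y.2) x (P x)
        ≤ familyCost α ρ₁ x.1 (p x.1)
          + ∫⁻ y₁, familyCost α ρ₂ x.2 (q ((x.1, y₁), x.2)) ∂p x.1 := by
      intro x
      simp only [familyCost, Fintype.sum_sum_type, Sum.elim_inl, Sum.elim_inr, hcost1]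
      rw [lintegral_finsetSum]
      · gcongr with j _
        exact hcost2 x j
      · intro j _
        exact (hmeas2 j).comp (by fun_prop : Measurable fun y₁ => ((x.1, y₁), x.2))
    calc _ ≤ ∫⁻ x, (familyCost α ρ₁ x.1 (p x.1)
          + ∫⁻ y₁, familyCost α ρ₂ x.2 (q ((x.1, y₁), x.2)) ∂p x.1) ∂ν₁ := lintegral_mono hpoint
      _ = ∫⁻ x₁, familyCost α ρ₁ x₁ (p x₁) ∂ν₁.fst
          + ∫⁻ w, ∫⁻ x₂, familyCost α ρ₂ x₂ (q (w, x₂)) ∂ν₁.condKernel w.1 ∂m := by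
        rw [lintegral_add_left (f := fun x : E₁ × E₂ => familyCost α ρ₁ x.1 (p x.1))
          (hmeasp.comp measurable_fst), Measure.fst,
          lintegral_map hmeasp measurable_fst]
        congr 1
        exact lintegral_condKernel_swap ν₁ p hmeasq
      _ ≤ (a₁ * klDiv ν₁.fst μ₁ + a₂ * klDiv ν₂.fst μ₁ + ε / 2) + ∫⁻ w, h w ∂m := by
        refine add_le_add hpc (lintegral_mono_ae ?_)
        filter_upwards [hqae] with w hw using hw.2
      _ = (a₁ * klDiv ν₁.fst μ₁ + a₂ * klDiv ν₂.fst μ₁ + ε / 2)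
          + (a₁ * ∫⁻ x, f₁ x ∂ν₁.fst + a₂ * ∫⁻ x, f₂ x ∂ν₂.fst + ε / 2) := by
        congr 1
        simp only [h]
        rw [lintegral_add_right _ measurable_const, lintegral_add_left (by fun_prop),
          lintegral_const_mul _ (by fun_prop), lintegral_const_mul _ (by fun_prop)]
        congr 1
        · rw [← hm1, ← hm2, Measure.fst, Measure.snd, lintegral_map hf₁ measurable_fst,
            lintegral_map hf₂ measurable_snd]
        · simp
      _ = _ := by
        rw [hchain₁, hchain₂, mul_add, mul_add]
        conv_rhs => rw [← ENNReal.add_halves ε]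
        ring

end Tensorization

section Product

open InformationTheory

lemma HasEntropyCouplings.map_equiv {E E' ι ι' : Type*} [MeasurableSpace E] [MeasurableSpace E']
    [Fintype ι] [Fintype ι'] {α : ℝ≥0∞ → ℝ≥0∞} {ρ : ι → E → E → ℝ≥0∞} {ρ' : ι' → E' → E' → ℝ≥0∞}
    {γ : Measure E} [IsProbabilityMeasure γ] {a₁ a₂ : ℝ≥0∞} (h : HasEntropyCouplings α ρ γ a₁ a₂)
    (e : E ≃ᵐ E')
    (hcost : ∀ x (p : Measure E), familyCost α ρ' (e x) (p.map e) ≤ familyCost α ρ x p) :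
    HasEntropyCouplings α ρ' (γ.map e) a₁ a₂ := by
  intro ν₁ ν₂ hν₁ hν₂ ε hε
  obtain ⟨p, hp, hpν, hpc⟩ := h (ν₁.map e.symm) (ν₂.map e.symm)
    (Measure.isProbabilityMeasure_map e.symm.measurable.aemeasurable)
    (Measure.isProbabilityMeasure_map e.symm.measurable.aemeasurable) ε hε
  have hkl : ∀ ν : Measure E', IsProbabilityMeasure ν →
      klDiv (ν.map e.symm) γ ≤ klDiv ν (γ.map e) := by
    intro ν hν
    have := Measure.isProbabilityMeasure_map (μ := γ) e.measurable.aemeasurable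
    have h := klDiv_map_le (μ := ν) (ν := γ.map e) e.symm.measurable
    rwa [MeasurableEquiv.map_symm_map] at h
  let p' : Kernel E' E' := (p.comap e.symm e.symm.measurable).map e
  have hp' : ∀ x, p' x = (p (e.symm x)).map e := fun x => by
    rw [Kernel.map_apply _ e.measurable, Kernel.comap_apply]
  refine ⟨p', Kernel.IsMarkovKernel.map _ e.measurable, ?_, ?_⟩
  · refine Measure.ext_of_lintegral _ fun f hf => ?_
    have hfe : Measurable fun x => f (e x) := hf.comp e.measurable
    rw [Measure.lintegral_bind p'.aemeasurable hf.aemeasurable]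
    simp only [hp', lintegral_map hf e.measurable]
    calc ∫⁻ x, ∫⁻ y, f (e y) ∂p (e.symm x) ∂ν₁
        = ∫⁻ x, ∫⁻ y, f (e y) ∂p x ∂(ν₁.map e.symm) :=
          (lintegral_map hfe.lintegral_kernel e.symm.measurable).symm
      _ = ∫⁻ y, f (e y) ∂(ν₂.map e.symm) := by
          rw [← hpν, Measure.lintegral_bind p.aemeasurable hfe.aemeasurable]
      _ = ∫⁻ y, f y ∂ν₂ := by
          rw [lintegral_map hfe e.symm.measurable]
          simp
  · calc ∫⁻ x, familyCost α ρ' x (p' x) ∂ν₁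
        ≤ ∫⁻ x, familyCost α ρ (e.symm x) (p (e.symm x)) ∂ν₁ := by
          refine lintegral_mono fun x => ?_
          rw [hp']
          conv_lhs => rw [← e.apply_symm_apply x, e.symm_apply_apply]
          exact hcost _ _
      _ = ∫⁻ x, familyCost α ρ x (p x) ∂(ν₁.map e.symm) :=
          (lintegral_map_equiv (fun x => familyCost α ρ x (p x)) e.symm).symm
      _ ≤ _ := hpc
      _ ≤ _ := by gcongr <;> exact hkl _ inferInstance

/-- The transport-entropy inequality yields almost optimal couplings; when its right-hand side is
infinite the independent coupling is used. -/
lemma hasEntropyCouplings_of_transportEntropyInequality {E : Type*} [MeasurableSpace E]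
    {α : ℝ≥0∞ → ℝ≥0∞} {ρ : E → E → ℝ≥0∞} {γ : Measure E} {a₁ a₂ : ℝ≥0∞}
    (h : TransportEntropyInequality (martonCost α ρ) γ a₁ a₂) :
    HasEntropyCouplings α (fun _ : Unit => ρ) γ a₁ a₂ := by
  intro ν₁ ν₂ hν₁ hν₂ ε hε
  rcases eq_or_ne (a₁ * klDiv ν₁ γ + a₂ * klDiv ν₂ γ) ⊤ with htop | htop
  · exact ⟨Kernel.const _ ν₂, inferInstance, by simp, by rw [htop, top_add]; exact le_top⟩
  have hlt : transportCost (martonCost α ρ) ν₂ ν₁ < a₁ * klDiv ν₁ γ + a₂ * klDiv ν₂ γ + ε :=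
    (h ⟨ν₁, hν₁⟩ ⟨ν₂, hν₂⟩).trans_lt (ENNReal.lt_add_right htop hε)
  obtain ⟨r, ⟨N, p, hp, hN, hNp, rfl⟩, hr⟩ := sInf_lt_iff.1 hlt
  refine ⟨p, hp, ?_, le_of_eq_of_le ?_ hr.le⟩
  · rw [← hN.2, hNp]
    exact (Measure.snd_compProd _ _).symm
  · simp [familyCost, martonCost]

lemma measurable_uncurry_apply {E : Type*} [MeasurableSpace E] {ρ : E → E → ℝ≥0∞}
    (hρ : Measurable (Function.uncurry ρ)) {n : ℕ} (i : Fin n) :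
    Measurable (Function.uncurry fun x y : Fin n → E => ρ (x i) (y i)) :=
  hρ.comp (by fun_prop : Measurable fun z : (Fin n → E) × (Fin n → E) => (z.1 i, z.2 i))

/-- Tensorization to a finite power. -/
theorem HasEntropyCouplings.pi {E : Type*} [MeasurableSpace E] [StandardBorelSpace E] [Nonempty E]
    {α : ℝ≥0∞ → ℝ≥0∞} (hc : ConvexOn ℝ≥0 Set.univ α) (hα : Monotone α) (htop : ContinuousAt α ⊤)
    {ρ : E → E → ℝ≥0∞} (hρ : Measurable (Function.uncurry ρ))
    {γ : Measure E} [IsProbabilityMeasure γ] {a₁ a₂ : ℝ≥0∞} (ha₁ : a₁ ≠ 0) (ha₂ : a₂ ≠ 0)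
    (h : HasEntropyCouplings α (fun _ : Unit => ρ) γ a₁ a₂) (n : ℕ) :
    HasEntropyCouplings α (fun (i : Fin n) (x y : Fin n → E) => ρ (x i) (y i))
      (Measure.pi fun _ => γ) a₁ a₂ := by
  induction n with
  | zero =>
    intro ν₁ ν₂ hν₁ hν₂ ε hε
    exact ⟨Kernel.const _ ν₂, inferInstance, by simp, by simp [familyCost]⟩
  | succ n ih =>
    let e := MeasurableEquiv.piFinSuccAbove (fun _ : Fin (n + 1) => E) 0
    have hmp : (γ.prod (Measure.pi fun _ : Fin n => γ)).map e.symm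
        = Measure.pi fun _ : Fin (n + 1) => γ :=
      (measurePreserving_piFinSuccAbove (fun _ : Fin (n + 1) => γ) 0).symm.map_eq
    rw [← hmp]
    refine (HasEntropyCouplings.prod hc hα htop (fun _ => hρ) (measurable_uncurry_apply hρ) ha₁ ha₂ h ih).map_equiv
      e.symm fun x p => le_of_eq ?_
    have hint : ∀ i : Fin (n + 1), ∫⁻ y, ρ (e.symm x i) (y i) ∂(p.map e.symm)
        = ∫⁻ y, ρ (e.symm x i) (e.symm y i) ∂p := fun i => lintegral_map_equiv _ e.symm
    simp only [familyCost, Fintype.sum_sum_type, Fin.sum_univ_succ, hint, Finset.univ_unique,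
      Finset.sum_singleton, Sum.elim_inl, Sum.elim_inr]
    rfl

end Product

/-! ### Configurations and orderings of their points -/

section Orderings

/-- A Hausdorff continuous image of a second countable space is countably separated: the
complement of its diagonal is Lindelöf, hence covered by countably many disjoint open boxes. -/
lemma countablySeparated_of_continuous_surjective {X Y : Type*} [TopologicalSpace X]
    [SecondCountableTopology X] [TopologicalSpace Y] [T2Space Y] [MeasurableSpace Y]
    [OpensMeasurableSpace Y] {f : X → Y} (hf : Continuous f) (hs : Function.Surjective f) :
    MeasurableSpace.CountablySeparated Y := by
  let T : Set (Y × Y) := {p | p.1 ≠ p.2}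
  have hT : IsLindelof T := by
    have hsurj := hs.prodMap hs
    rw [← image_preimage_eq T hsurj]
    exact (HereditarilyLindelofSpace.isLindelof _).image (hf.prodMap hf)
  have hsep : ∀ p : Y × Y, ∃ UV : Set Y × Set Y, p ∈ T →
      IsOpen UV.1 ∧ IsOpen UV.2 ∧ p.1 ∈ UV.1 ∧ p.2 ∈ UV.2 ∧ Disjoint UV.1 UV.2 := by
    intro p
    by_cases hp : p ∈ T
    · obtain ⟨U, V, h⟩ := t2_separation hp
      exact ⟨(U, V), fun _ => h⟩
    · exact ⟨(∅, ∅), fun h => absurd h hp⟩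
  choose UV hUV using hsep
  obtain ⟨t, htc, htT, ht⟩ := hT.elim_nhds_subcover (fun p => (UV p).1 ×ˢ (UV p).2) fun p hp => by
    obtain ⟨h1, h2, h3, h4, -⟩ := hUV p hp
    exact (h1.prod h2).mem_nhds ⟨h3, h4⟩
  refine ⟨⟨⟨(fun p => (UV p).1) '' t, htc.image _, ?_, ?_⟩⟩⟩
  · rintro _ ⟨p, hp, rfl⟩
    exact (hUV p (htT p hp)).1.measurableSet
  · intro a _ b _ hab
    by_contra hne
    obtain ⟨p, hp, hmem⟩ := mem_iUnion₂.1 (ht (show (a, b) ∈ T from hne))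
    have hb := (hab _ ⟨p, hp, rfl⟩).1 hmem.1
    exact disjoint_left.1 (hUV p (htT p hp)).2.2.2.2 hb hmem.2

variable {Z : Type*} [MeasurableSpace Z]

lemma toMeasure_diracSum {n : ℕ} (x : Fin n → Z) :
    (diracSum x).toMeasure = ∑ i, Measure.dirac (x i) := rfl

lemma diracSum_surjective (n : ℕ) :
    Function.Surjective (diracSum : (Fin n → Z) → Configuration Z n) := by
  rintro ⟨ξ, ⟨k, a, ha⟩, hn⟩
  have hk : k = n := by
    rw [ha] at hn
    simpa using hn
  subst hk
  exact ⟨a, Subtype.ext (Subtype.ext ha.symm)⟩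

lemma diracSum_comp_perm {n : ℕ} (x : Fin n → Z) (σ : Equiv.Perm (Fin n)) :
    diracSum (x ∘ σ) = diracSum x := by
  refine Subtype.ext (Subtype.ext ?_)
  exact Equiv.sum_comp σ fun i => Measure.dirac (x i)

open scoped Classical in
lemma toMeasure_diracSum_singleton [MeasurableSingletonClass Z] {n : ℕ} (x : Fin n → Z) (z : Z) :
    (diracSum x).toMeasure {z} = (Finset.univ.filter fun i => x i = z).card := by
  rw [toMeasure_diracSum, Measure.finsetSum_apply, Finset.card_filter]
  push_cast
  refine Finset.sum_congr rfl fun i _ => ?_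
  rw [Measure.dirac_apply]
  by_cases h : x i = z <;> simp [h]

lemma exists_perm_of_diracSum_eq [MeasurableSingletonClass Z] {n : ℕ} {x y : Fin n → Z}
    (h : diracSum x = diracSum y) : ∃ σ : Equiv.Perm (Fin n), y ∘ σ = x := by
  classical
  have hcard : ∀ z, Fintype.card {i // x i = z} = Fintype.card {i // y i = z} := by
    intro z
    have h1 := toMeasure_diracSum_singleton x z
    rw [h, toMeasure_diracSum_singleton y z] at h1
    rw [Fintype.card_subtype, Fintype.card_subtype]
    exact_mod_cast h1.symm
  refine ⟨Equiv.ofFiberEquiv fun z => Fintype.equivOfCardEq (hcard z), ?_⟩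
  funext i
  exact Equiv.ofFiberEquiv_map _ i

/-- The law of a uniformly random rearrangement of `x`. -/
def uniformOrdering {n : ℕ} (x : Fin n → Z) : Measure (Fin n → Z) :=
  (n.factorial : ℝ≥0∞)⁻¹ • ∑ σ : Equiv.Perm (Fin n), Measure.dirac (x ∘ σ)

lemma lintegral_uniformOrdering [MeasurableSingletonClass Z] {n : ℕ} (x : Fin n → Z)
    (f : (Fin n → Z) → ℝ≥0∞) :
    ∫⁻ y, f y ∂uniformOrdering x
      = (n.factorial : ℝ≥0∞)⁻¹ * ∑ σ : Equiv.Perm (Fin n), f (x ∘ σ) := by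
  simp [uniformOrdering, lintegral_smul_measure, lintegral_finsetSum_measure]

lemma inv_factorial_mul_sum_perm_const (n : ℕ) (c : ℝ≥0∞) :
    (n.factorial : ℝ≥0∞)⁻¹ * ∑ _σ : Equiv.Perm (Fin n), c = c := by
  rw [Finset.sum_const, Finset.card_univ, Fintype.card_perm, Fintype.card_fin, nsmul_eq_mul,
    ← mul_assoc, ENNReal.inv_mul_cancel (by exact_mod_cast n.factorial_ne_zero)
      (ENNReal.natCast_ne_top _), one_mul]

instance isProbabilityMeasure_uniformOrdering {n : ℕ} (x : Fin n → Z) :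
    IsProbabilityMeasure (uniformOrdering x) := by
  constructor
  have := inv_factorial_mul_sum_perm_const n 1
  simpa [uniformOrdering] using this

lemma measurable_comp_perm {n : ℕ} (σ : Equiv.Perm (Fin n)) :
    Measurable fun x : Fin n → Z => x ∘ σ :=
  measurable_pi_lambda _ fun i => measurable_pi_apply (σ i)

lemma measurable_uniformOrdering {n : ℕ} :
    Measurable (uniformOrdering : (Fin n → Z) → Measure (Fin n → Z)) := by
  refine Measure.measurable_of_measurable_coe _ fun s hs => ?_
  simp only [uniformOrdering, Measure.smul_apply, Measure.finsetSum_apply, smul_eq_mul]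
  refine Measurable.const_mul (Finset.measurable_fun_sum _ fun σ _ => ?_) _
  exact (Measure.measurable_coe hs).comp (Measure.measurable_dirac.comp (measurable_comp_perm σ))

lemma uniformOrdering_comp_perm [MeasurableSingletonClass Z] {n : ℕ} (x : Fin n → Z)
    (σ : Equiv.Perm (Fin n)) : uniformOrdering (x ∘ σ) = uniformOrdering x := by
  unfold uniformOrdering
  congr 1
  exact Equiv.sum_comp (Equiv.mulLeft σ) fun τ : Equiv.Perm (Fin n) => Measure.dirac (x ∘ τ)

variable [TopologicalSpace Z] [PolishSpace Z] [BorelSpace Z]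

instance t2Space_configuration (n : ℕ) : T2Space (Configuration Z n) := by
  let := TopologicalSpace.upgradeIsCompletelyMetrizable Z
  exact inferInstanceAs (T2Space {ξ : FiniteMeasure Z //
    IsFiniteConfiguration (ξ : Measure Z) ∧ (ξ : Measure Z) univ = n})

instance countablySeparated_configuration (n : ℕ) :
    MeasurableSpace.CountablySeparated (Configuration Z n) :=
  countablySeparated_of_continuous_surjective (continuous_diracSum n) (diracSum_surjective n)

/-- The kernel sending a configuration to the law of a uniformly random ordering of its points. It
is measurable since its composition with `diracSum` is, by Suslin's theorem on analytic sets
with analytic complement. -/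
def orderingKernel (Z : Type*) [MeasurableSpace Z] [TopologicalSpace Z] [PolishSpace Z]
    [BorelSpace Z] (n : ℕ) : Kernel (Configuration Z n) (Fin n → Z) where
  toFun ξ := uniformOrdering (Function.surjInv (diracSum_surjective n) ξ)
  measurable' := by
    rw [← (measurable_diracSum n).measurable_comp_iff_of_surjective (diracSum_surjective n)]
    convert measurable_uniformOrdering (Z := Z) (n := n) using 1
    funext x
    obtain ⟨σ, hσ⟩ := exists_perm_of_diracSum_eq
      (Function.surjInv_eq (diracSum_surjective n) (diracSum x))
    rw [Function.comp_apply, ← hσ, uniformOrdering_comp_perm]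

lemma orderingKernel_diracSum {n : ℕ} (x : Fin n → Z) :
    orderingKernel Z n (diracSum x) = uniformOrdering x := by
  obtain ⟨σ, hσ⟩ := exists_perm_of_diracSum_eq
    (Function.surjInv_eq (diracSum_surjective n) (diracSum x))
  change uniformOrdering (Function.surjInv (diracSum_surjective n) (diracSum x)) = _
  rw [← hσ, uniformOrdering_comp_perm]

instance isMarkovKernel_orderingKernel (n : ℕ) : IsMarkovKernel (orderingKernel Z n) :=
  ⟨fun _ => isProbabilityMeasure_uniformOrdering _⟩

/-- Ordering the points of a configuration and forgetting the order is the identity. -/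
lemma map_diracSum_orderingKernel {n : ℕ} (ν : Measure (Configuration Z n)) :
    (ν.bind (orderingKernel Z n)).map diracSum = ν := by
  refine Measure.ext_of_lintegral _ fun f hf => ?_
  have hfS : Measurable fun x : Fin n → Z => f (diracSum x) := hf.comp (measurable_diracSum n)
  rw [lintegral_map hf (measurable_diracSum n),
    Measure.lintegral_bind (orderingKernel Z n).aemeasurable hfS.aemeasurable]
  refine lintegral_congr fun ξ => ?_
  obtain ⟨x, rfl⟩ := diracSum_surjective n ξ
  simp only [orderingKernel_diracSum, lintegral_uniformOrdering, diracSum_comp_perm,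
    inv_factorial_mul_sum_perm_const]

/-- A uniformly random ordering of a binomial process is an i.i.d. sample. -/
lemma bind_orderingKernel_binomialProcess (μ : Measure Z) [IsProbabilityMeasure μ] (n : ℕ) :
    (binomialProcess μ n).bind (orderingKernel Z n) = Measure.pi fun _ => μ := by
  refine Measure.ext_of_lintegral _ fun f hf => ?_
  rw [Measure.lintegral_bind (orderingKernel Z n).aemeasurable hf.aemeasurable, binomialProcess,
    lintegral_map hf.lintegral_kernel (measurable_diracSum n)]
  simp only [orderingKernel_diracSum, lintegral_uniformOrdering]
  have hperm : ∀ σ : Equiv.Perm (Fin n),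
      ∫⁻ x, f (x ∘ σ) ∂(Measure.pi fun _ : Fin n => μ) = ∫⁻ x, f x ∂(Measure.pi fun _ => μ) := by
    intro σ
    have hmp := measurePreserving_arrowCongr' (fun _ : Fin n => μ) (fun _ : Fin n => μ) σ.symm
      (MeasurableEquiv.refl Z) fun _ => MeasurePreserving.id μ
    rw [← hmp.lintegral_comp hf]
    rfl
  rw [lintegral_const_mul, lintegral_finsetSum]
  · simp only [hperm, inv_factorial_mul_sum_perm_const]
  · exact fun σ _ => hf.comp (measurable_comp_perm σ)
  · exact Finset.measurable_fun_sum _ fun σ _ => hf.comp (measurable_comp_perm σ)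

end Orderings

/-! ### Comparison of the costs on ordered and unordered configurations -/

section PartialTransport

variable {Z : Type*} [MeasurableSpace Z]

lemma isFiniteConfiguration_sum_dirac {κ : Type*} (J : Finset κ) (y : κ → Z) :
    IsFiniteConfiguration (∑ j ∈ J, Measure.dirac (y j)) := by
  refine ⟨J.card, fun i => y (J.equivFin.symm i), ?_⟩
  rw [← Finset.sum_coe_sort J]
  exact (Equiv.sum_comp J.equivFin.symm fun j : J => Measure.dirac (y j)).symm

lemma sum_dirac_univ {κ : Type*} (J : Finset κ) (y : κ → Z) :
    (∑ j ∈ J, Measure.dirac (y j)) univ = J.card := by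
  simp

/-- The only coupling of a multiple of a Dirac mass at `z` with a configuration is the product
coupling. -/
lemma transportCost_smul_dirac_le [MeasurableSingletonClass Z] (ρ : Z → Z → ℝ≥0∞) (z : Z)
    {κ : Type*} (J : Finset κ) (hJ : J.Nonempty) (y : κ → Z) :
    transportCost (linearCost ρ) (∑ j ∈ J, Measure.dirac (y j))
      ((J.card : ℝ≥0∞) • Measure.dirac z) ≤ ∑ j ∈ J, ρ z (y j) := by
  have hJ0 : (J.card : ℝ≥0∞) ≠ 0 := by exact_mod_cast hJ.card_pos.ne'
  have hJt : (J.card : ℝ≥0∞) ≠ ⊤ := ENNReal.natCast_ne_top _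
  let χ : Measure Z := ∑ j ∈ J, Measure.dirac (y j)
  have hχ : χ univ = J.card := sum_dirac_univ J y
  have hP : IsProbabilityMeasure ((J.card : ℝ≥0∞)⁻¹ • χ) :=
    ⟨by rw [Measure.smul_apply, hχ, smul_eq_mul, ENNReal.inv_mul_cancel hJ0 hJt]⟩
  let p : Kernel Z Z := Kernel.const Z ((J.card : ℝ≥0∞)⁻¹ • χ)
  have hp : IsMarkovKernel p := inferInstance
  have hfin : IsFiniteMeasure ((J.card : ℝ≥0∞) • Measure.dirac z) :=
    Measure.smul_finite _ hJt
  refine sInf_le_of_le ⟨((J.card : ℝ≥0∞) • Measure.dirac z) ⊗ₘ p, p, hp,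
    ⟨Measure.fst_compProd _ _, ?_⟩, rfl, rfl⟩ (le_of_eq ?_)
  · rw [Measure.snd_compProd]
    change Measure.bind _ (fun _ => (J.card : ℝ≥0∞)⁻¹ • χ) = χ
    rw [Measure.bind_const, smul_smul, Measure.smul_apply, measure_univ, smul_eq_mul, mul_one,
      ENNReal.mul_inv_cancel hJ0 hJt, one_smul]
  · rw [lintegral_smul_measure, lintegral_dirac]
    change (J.card : ℝ≥0∞) • ∫⁻ y, ρ z y ∂((J.card : ℝ≥0∞)⁻¹ • χ) = _
    rw [lintegral_smul_measure, smul_smul, smul_eq_mul, ENNReal.mul_inv_cancel hJ0 hJt,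
      one_mul, lintegral_finsetSum_measure]
    simp only [lintegral_dirac]

/-- Sending the mass at a point `z`, carried by the indices in `J`, to the points `y j` with
`j ∈ J` is admissible for the partial transport cost. -/
lemma partialTransportCost_diracSum_le [MeasurableSingletonClass Z] (ρ : Z → Z → ℝ≥0∞) (z : Z)
    {n : ℕ} (J : Finset (Fin n)) (hJ : J.Nonempty) (y : Fin n → Z) :
    partialTransportCost (linearCost ρ) (diracSum y).toMeasure
      ((J.card : ℝ≥0∞) • Measure.dirac z) ≤ ∑ j ∈ J, ρ z (y j) := by
  have hy : (diracSum y).toMeasure univ = n := by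
    rw [toMeasure_diracSum]; simp
  have hz : ((J.card : ℝ≥0∞) • Measure.dirac z : Measure Z) univ = J.card := by simp
  have hcard : J.card ≤ n := by simpa using Finset.card_le_univ J
  unfold partialTransportCost
  rw [hy, hz]
  split_ifs with h
  · -- `J` contains all indices
    have hJn : J.card = n := le_antisymm hcard (by exact_mod_cast h)
    have hJu : J = Finset.univ := (Finset.card_eq_iff_eq_univ J).1 (by simpa using hJn)
    refine sInf_le_of_le ⟨(J.card : ℝ≥0∞) • Measure.dirac z, ?_, le_rfl, ?_, rfl⟩ ?_
    · have := isFiniteConfiguration_sum_dirac J fun _ => z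
      rwa [Finset.sum_const, ← Nat.cast_smul_eq_nsmul ℝ≥0∞] at this
    · rw [hz, hJn]
    · have := transportCost_smul_dirac_le ρ z J hJ y
      rwa [toMeasure_diracSum, ← hJu]
  · refine sInf_le_of_le ⟨∑ j ∈ J, Measure.dirac (y j), isFiniteConfiguration_sum_dirac J y, ?_,
      sum_dirac_univ J y, rfl⟩ (transportCost_smul_dirac_le ρ z J hJ y)
    rw [toMeasure_diracSum]
    rw [← Finset.sum_sdiff (Finset.subset_univ J)]
    exact Measure.le_add_left le_rfl

end PartialTransport

section Comparison

variable {α : ℝ≥0∞ → ℝ≥0∞}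

lemma map_average_le_average (hc : ConvexOn ℝ≥0 Set.univ α) (hα : Monotone α)
    (htop : ContinuousAt α ⊤) {n : ℕ} (J : Finset (Fin n)) (hJ : J.Nonempty) (u : Fin n → ℝ≥0∞) :
    α ((J.card : ℝ≥0∞)⁻¹ * ∑ j ∈ J, u j) ≤ (J.card : ℝ≥0∞)⁻¹ * ∑ j ∈ J, α (u j) := by
  let P : Measure (Fin n) := (J.card : ℝ≥0∞)⁻¹ • ∑ j ∈ J, Measure.dirac j
  have hP : IsProbabilityMeasure P := ⟨by
    rw [Measure.smul_apply, sum_dirac_univ J fun j => j, smul_eq_mul,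
      ENNReal.inv_mul_cancel (by exact_mod_cast hJ.card_pos.ne') (ENNReal.natCast_ne_top _)]⟩
  have hint : ∀ v : Fin n → ℝ≥0∞, ∫⁻ j, v j ∂P = (J.card : ℝ≥0∞)⁻¹ * ∑ j ∈ J, v j := fun v => by
    rw [lintegral_smul_measure, lintegral_finsetSum_measure, smul_eq_mul]
    simp only [lintegral_dirac]
  rw [← hint, ← hint]
  exact map_lintegral_le_lintegral hc hα htop P u

variable {Z : Type*} [MeasurableSpace Z] [TopologicalSpace Z] [PolishSpace Z] [BorelSpace Z]

/-- Let `x` be an ordering of a configuration and `Q` a law on `Z ^ n`. The cost of the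
configuration with respect to the image of `Q` is at most the cost of `x` with respect to `Q`. -/
lemma sum_binomialMartonCost_le (hc : ConvexOn ℝ≥0 Set.univ α) (hα : Monotone α)
    (htop : ContinuousAt α ⊤) {ρ : Z → Z → ℝ≥0∞} (hρ : Measurable (Function.uncurry ρ)) {n : ℕ}
    (x : Fin n → Z) (Q : Measure (Fin n → Z)) :
    ∫⁻ z, α (((diracSum x).toMeasure {z})⁻¹ *
        ∫⁻ y, partialTransportCost (linearCost ρ) (diracSum y).toMeasure
          ((diracSum x).toMeasure {z} • Measure.dirac z) ∂Q) ∂(diracSum x).toMeasure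
      ≤ familyCost α (fun (i : Fin n) (x y : Fin n → Z) => ρ (x i) (y i)) x Q := by
  classical
  let J : Fin n → Finset (Fin n) := fun i => Finset.univ.filter fun j => x j = x i
  have hJ : ∀ i, (J i).Nonempty := fun i => ⟨i, by simp [J]⟩
  have hsymm : ∀ i j, j ∈ J i ↔ i ∈ J j := fun i j => by simp [J, eq_comm]
  have hJeq : ∀ i j, j ∈ J i → J j = J i := fun i j hj => by
    have : x j = x i := by simpa [J] using hj
    simp [J, this]
  let u : Fin n → ℝ≥0∞ := fun j => ∫⁻ y, ρ (x j) (y j) ∂Q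
  have hu : ∀ j, Measurable fun y : Fin n → Z => ρ (x j) (y j) := fun j =>
    hρ.comp (by fun_prop : Measurable fun y : Fin n → Z => (x j, y j))
  have hpoint : ∀ i, α (((diracSum x).toMeasure {x i})⁻¹ *
        ∫⁻ y, partialTransportCost (linearCost ρ) (diracSum y).toMeasure
          ((diracSum x).toMeasure {x i} • Measure.dirac (x i)) ∂Q)
      ≤ ((J i).card : ℝ≥0∞)⁻¹ * ∑ j ∈ J i, α (u j) := by
    intro i
    have hmass : (diracSum x).toMeasure {x i} = (J i).card := by
      rw [toMeasure_diracSum_singleton]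
    rw [hmass]
    refine (hα ?_).trans (map_average_le_average hc hα htop (J i) (hJ i) u)
    gcongr
    calc ∫⁻ y, partialTransportCost (linearCost ρ) (diracSum y).toMeasure
          (((J i).card : ℝ≥0∞) • Measure.dirac (x i)) ∂Q
        ≤ ∫⁻ y, ∑ j ∈ J i, ρ (x j) (y j) ∂Q := by
          refine lintegral_mono fun y => ?_
          refine (partialTransportCost_diracSum_le ρ (x i) (J i) (hJ i) y).trans (le_of_eq ?_)
          refine Finset.sum_congr rfl fun j hj => ?_
          have : x j = x i := by simpa [J] using hj
          rw [this]
      _ = ∑ j ∈ J i, u j := lintegral_finsetSum _ fun j _ => hu j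
  rw [toMeasure_diracSum, lintegral_finsetSum_measure]
  simp only [lintegral_dirac]
  rw [← toMeasure_diracSum]
  calc _ ≤ ∑ i, ((J i).card : ℝ≥0∞)⁻¹ * ∑ j ∈ J i, α (u j) :=
        Finset.sum_le_sum fun i _ => hpoint i
    _ = ∑ i, ∑ j ∈ J i, ((J j).card : ℝ≥0∞)⁻¹ * α (u j) := by
        refine Finset.sum_congr rfl fun i _ => ?_
        rw [Finset.mul_sum]
        exact Finset.sum_congr rfl fun j hj => by rw [hJeq i j hj]
    _ = ∑ j, ∑ i ∈ J j, ((J j).card : ℝ≥0∞)⁻¹ * α (u j) :=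
        Finset.sum_comm' fun i j => by simp [hsymm i j]
    _ = ∑ j, α (u j) := by
        refine Finset.sum_congr rfl fun j _ => ?_
        rw [Finset.sum_const, nsmul_eq_mul, ← mul_assoc, ENNReal.mul_inv_cancel
          (by exact_mod_cast (hJ j).card_pos.ne') (ENNReal.natCast_ne_top _), one_mul]

/-- Ordering a configuration at random, applying a kernel `p` on `Z ^ n` and forgetting the order
does not increase the cost. -/
lemma binomialMartonCost_le_lintegral (hc : ConvexOn ℝ≥0 Set.univ α) (hα : Monotone α)
    (htop : ContinuousAt α ⊤) {ρ : Z → Z → ℝ≥0∞} (hρ : Measurable (Function.uncurry ρ)) {n : ℕ}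
    (p : Kernel (Fin n → Z) (Fin n → Z)) (ξ : Configuration Z n)
    (Q : ProbabilityMeasure (Configuration Z n))
    (hQ : (Q : Measure (Configuration Z n))
      = (orderingKernel Z n ξ).bind fun x => (p x).map diracSum) :
    binomialMartonCost α ρ n ξ Q ≤ ∫⁻ x,
      familyCost α (fun (i : Fin n) (x y : Fin n → Z) => ρ (x i) (y i)) x (p x)
        ∂orderingKernel Z n ξ := by
  obtain ⟨x₀, rfl⟩ := diracSum_surjective n ξ
  let T : Z → (Fin n → Z) → ℝ≥0∞ := fun z x =>
    α (((diracSum x₀).toMeasure {z})⁻¹ *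
      ∫⁻ y, partialTransportCost (linearCost ρ) (diracSum y).toMeasure
        ((diracSum x₀).toMeasure {z} • Measure.dirac z) ∂p x)
  have hT : ∀ z, α (((diracSum x₀).toMeasure {z})⁻¹ *
      ∫⁻ χ, partialTransportCost (linearCost ρ) χ.toMeasure
        ((diracSum x₀).toMeasure {z} • Measure.dirac z) ∂(Q : Measure (Configuration Z n)))
      ≤ ∫⁻ x, T z x ∂uniformOrdering x₀ := by
    intro z
    refine le_trans (hα ?_) (map_lintegral_le_lintegral hc hα htop _ _)
    refine le_trans ?_ (lintegral_const_mul_le _ _)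
    gcongr
    rw [hQ, orderingKernel_diracSum]
    refine (Measure.lintegral_bind_le _ _ _).trans (lintegral_mono fun x => ?_)
    exact lintegral_map_le _ _
  rw [orderingKernel_diracSum]
  unfold binomialMartonCost
  calc _ ≤ ∫⁻ z, ∫⁻ x, T z x ∂uniformOrdering x₀ ∂(diracSum x₀).toMeasure := lintegral_mono hT
    _ = ∫⁻ x, ∫⁻ z, T z x ∂(diracSum x₀).toMeasure ∂uniformOrdering x₀ := by
      simp only [toMeasure_diracSum x₀, lintegral_finsetSum_measure, lintegral_dirac,
        lintegral_uniformOrdering]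
      rw [← Finset.mul_sum, Finset.sum_comm]
    _ ≤ _ := by
      rw [lintegral_uniformOrdering, lintegral_uniformOrdering]
      gcongr with σ _
      have := sum_binomialMartonCost_le hc hα htop hρ (x₀ ∘ σ) (p (x₀ ∘ σ))
      rwa [diracSum_comp_perm] at this

end Comparison

end MartonBinomial

end

theorem theorem3p4 {Z : Type*} [MetricSpace Z] [CompleteSpace Z] [SecondCountableTopology Z]
    [MeasurableSpace Z] [BorelSpace Z] (n : ℕ) (μ : ProbabilityMeasure Z)
    (a₁ a₂ : ℝ≥0∞) (ha₁ : 0 < a₁) (ha₂ : 0 < a₂)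
    (ρ : Z → Z → ℝ≥0∞) (hρ : LowerSemicontinuous fun z : Z × Z => ρ z.1 z.2)
    (α : ℝ≥0∞ → ℝ≥0∞) (hα_convex : ConvexOn ℝ≥0 Set.univ α) (hα_mono : Monotone α)
    (hα_top : ContinuousAt α ⊤)
    (hμ : MartonBinomial.TransportEntropyInequality (MartonBinomial.martonCost α ρ)
      (μ : Measure Z) a₁ a₂) :
    MartonBinomial.TransportEntropyInequality (MartonBinomial.binomialMartonCost α ρ n)
      (MartonBinomial.binomialProcess (μ : Measure Z) n) a₁ a₂ := by
  open MartonBinomial InformationTheory in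
  have hZ : Nonempty Z := μ.nonempty
  have hρm : Measurable (Function.uncurry ρ) := hρ.measurable
  have hpi := (hasEntropyCouplings_of_transportEntropyInequality hμ).pi hα_convex hα_mono hα_top
    hρm ha₁.ne' ha₂.ne' n
  have hB := isProbabilityMeasure_binomialProcess (μ : Measure Z) n
  have hkl : ∀ ν : ProbabilityMeasure (Configuration Z n),
      klDiv ((ν : Measure (Configuration Z n)).bind (orderingKernel Z n))
        (Measure.pi fun _ : Fin n => (μ : Measure Z))
      ≤ klDiv (ν : Measure (Configuration Z n)) (binomialProcess (μ : Measure Z) n) := by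
    intro ν
    rw [← bind_orderingKernel_binomialProcess]
    exact klDiv_comp_right_le _ _ _
  intro ν₁ ν₂
  refine ENNReal.le_of_forall_pos_le_add fun ε hε _ => ?_
  obtain ⟨p, hp, hpν, hpc⟩ := hpi ((ν₁ : Measure (Configuration Z n)).bind (orderingKernel Z n))
    ((ν₂ : Measure (Configuration Z n)).bind (orderingKernel Z n)) inferInstance inferInstance ε
    (by exact_mod_cast hε.ne')
  let P : Kernel (Configuration Z n) (Configuration Z n) := (p.map diracSum) ∘ₖ orderingKernel Z n
  have hmap : IsMarkovKernel (p.map (diracSum : (Fin n → Z) → Configuration Z n)) :=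
    Kernel.IsMarkovKernel.map p (measurable_diracSum n)
  have hP : IsMarkovKernel P := inferInstance
  have hPξ : ∀ ξ, P ξ = (orderingKernel Z n ξ).bind fun x => (p x).map diracSum := by
    intro ξ
    rw [Kernel.comp_apply]
    congr 1
    funext x
    exact Kernel.map_apply _ (measurable_diracSum n) x
  refine sInf_le_of_le ⟨(ν₁ : Measure (Configuration Z n)) ⊗ₘ P, P, hP,
    ⟨Measure.fst_compProd _ _, ?_⟩, rfl, rfl⟩ ?_
  · rw [Measure.snd_compProd, ← Measure.comp_assoc, ← map_diracSum_orderingKernel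
        (ν₂ : Measure (Configuration Z n)), ← hpν, Measure.map_comp _ _ (measurable_diracSum n)]
  · have hG : Measurable fun x => familyCost α
        (fun (i : Fin n) (x y : Fin n → Z) => ρ (x i) (y i)) x (p x) :=
      measurable_familyCost hα_mono.measurable (fun i => measurable_uncurry_apply hρm i) p
        measurable_id
    calc _ ≤ ∫⁻ ξ, ∫⁻ x, familyCost α (fun (i : Fin n) (x y : Fin n → Z) => ρ (x i) (y i)) x (p x)
            ∂orderingKernel Z n ξ ∂(ν₁ : Measure (Configuration Z n)) :=
          lintegral_mono fun ξ => binomialMartonCost_le_lintegral hα_convex hα_mono hα_top hρm p ξ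
            ⟨P ξ, hP.isProbabilityMeasure ξ⟩ (hPξ ξ)
      _ = ∫⁻ x, familyCost α (fun (i : Fin n) (x y : Fin n → Z) => ρ (x i) (y i)) x (p x)
            ∂(ν₁ : Measure (Configuration Z n)).bind (orderingKernel Z n) :=
          (Measure.lintegral_bind (orderingKernel Z n).aemeasurable hG.aemeasurable).symm
      _ ≤ _ := hpc
      _ ≤ _ := by gcongr <;> exact hkl _
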